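/- Let $l\ge 2$ and let $S^l\subset\mathbb R^{l+1}$ be the unit sphere. A *hypersphere* is a set $S=H\cap S^l$, with $H$ an affine hyperplane, that is neither empty nor a single point. An *arrangement of spheres* $\mathcal A$ is a finite collection of hyperspheres such that (1) every intersection $\mathcal A_I$ of members of $\mathcal A$ is a sphere of some dimension (the empty set being the sphere of dimension $-1$, a pair of points a sphere of dimension $0$); (2) if $\mathcal A_I\not\subseteq S$ with $S\in\mathcal A$, then $\mathcal A_I\cap S$ is a sphere of dimension $\dim\mathcal A_I-1$; (3) $\mathcal A$ decomposes $S^l$ into a regular cell complex. It is *centrally symmetric* if every member is $H\cap S^l$ for a linear subspace $H$ of codimension one. The *faces* of $\mathcal A$ are the connected components of its strata (sets of points of $S^l$ lying on exactly the same members of $\mathcal A$); *chambers* are the faces of codimension $0$. For chambers $C,D$ let $d(C,D)$ be the number of $S\in\mathcal A$ separating them, and for a face $F$ let $F\circ C$ be the chamber $E$ with $F\subset\overline E$ for which $d(C,E)$ is minimal. The *Salvetti complex* $Sal(\mathcal A)$ has a $k$-cell $\langle F;C\rangle$ for every face $F$ of codimension $k$ and every chamber $C$ with $F\subset\overline C$;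 its boundary consists of the cells $\langle F';F'\circ C\rangle$ with $F\subset\overline{F'}$, $F'\ne F$. The $1$-cell $\langle F;C\rangle$ is oriented from $\langle C;C\rangle$ to $\langle D;D\rangle$, where $D\neq C$ is the other chamber with $F\subset\overline D$. A *positive path* is a sequence of consecutive edges of the $1$-skeleton, all traversed in the positive direction; it is *minimal* if no edge path (with edges traversed in either direction) with the same end points is shorter. The *positive category* $\mathcal G^+$ has the vertices of $Sal(\mathcal A)$ as objects, and as morphisms the positive paths modulo *positive equivalence*: the equivalence relation generated by replacing, inside a positive path, a minimal positive path by another minimal positive path with the same end points such that both run in the boundary of a common $2$-cell of $Sal(\mathcal A)$. The *arrangement groupoid* $\mathcal G$ is the category of fractions of $\mathcal G^+$, obtained by inverting all morphisms (equivalently, the edge-path groupoid of $Sal(\mathcal A)$), and $J\colon\mathcal G^+\to\mathcal G$ is the canonical functor. **Theorem.** Let $\mathcal A$ be a centrally symmetric arrangement of spheres in $S^l$, $l\ge2$. Then $J$ is faithful on the class of minimal positive paths: if $\alpha,\beta$ are minimal positive paths with the same initial and the same terminal vertex and $J[\alpha]_+=J[\beta]_+$, then $[\alpha]_+=[\beta]_+$.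 Moreover, any two minimal positive paths with the same initial and the same terminal vertex are positively equivalent. -/

import Mathlib

open CategoryTheory

/-- The Euclidean space containing the unit sphere of dimension `l`. -/
abbrev SphAmbient (l : ℕ) : Type := EuclideanSpace ℝ (Fin (l + 1))

namespace SphArr

/-- The unit sphere of dimension `l`. -/
def unitSphere (l : ℕ) : Set (SphAmbient l) := Metric.sphere 0 1

/-- `IsSphereOfDimSucc n X`: the set `X` is a (round) sphere of dimension `n - 1`, that is, the set
of points at some fixed distance `r > 0` from a point `c` in an `n`-dimensional affine subspace.
For `n = 0` this is the empty set (the sphere of dimension `-1`), for `n = 1` a pair of points. -/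
def IsSphereOfDimSucc {l : ℕ} (n : ℕ) (X : Set (SphAmbient l)) : Prop :=
  ∃ (P : AffineSubspace ℝ (SphAmbient l)) (c : SphAmbient l) (r : ℝ),
    c ∈ P ∧ 0 < r ∧ Module.finrank ℝ P.direction = n ∧
      X = (P : Set (SphAmbient l)) ∩ Metric.sphere c r

/-- A hypersphere of the unit sphere: its intersection with an affine hyperplane, provided that
this intersection is neither empty nor a single point. -/
def IsHypersphere (l : ℕ) (S : Set (SphAmbient l)) : Prop :=
  S.Nontrivial ∧ ∃ H : AffineSubspace ℝ (SphAmbient l),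
    (H : Set (SphAmbient l)).Nonempty ∧ Module.finrank ℝ H.direction = l ∧
      S = (H : Set (SphAmbient l)) ∩ unitSphere l

/-- The intersection (inside the unit sphere) of a family of subsets; the empty family gives the
whole unit sphere. -/
def inter (l : ℕ) (I : Set (Set (SphAmbient l))) : Set (SphAmbient l) :=
  {x | x ∈ unitSphere l ∧ ∀ S ∈ I, x ∈ S}

section faces

variable {l : ℕ} (𝒜 : Set (Set (SphAmbient l)))

/-- The stratum through `x`: the points of the unit sphere that lie on exactly the same members
of the collection as `x`. -/
def stratum (x : SphAmbient l) : Set (SphAmbient l) :=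
  {y | y ∈ unitSphere l ∧ ∀ S ∈ 𝒜, y ∈ S ↔ x ∈ S}

/-- Faces are the connected components of the strata. -/
def IsFace (F : Set (SphAmbient l)) : Prop :=
  ∃ x ∈ unitSphere l, F = connectedComponentIn (stratum 𝒜 x) x

/-- The intersection of all members of the collection that contain `F`. -/
def support (F : Set (SphAmbient l)) : Set (SphAmbient l) :=
  inter l {S | S ∈ 𝒜 ∧ F ⊆ S}

/-- `F` is a face of dimension `d`: a face in which the members of the collection containing `F`
intersect in a sphere of dimension `d` (of which `F` is a relatively open subset). -/
def IsFaceOfDim (d : ℕ) (F : Set (SphAmbient l)) : Prop :=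
  IsFace 𝒜 F ∧ IsSphereOfDimSucc (d + 1) (support 𝒜 F)

/-- `F` is a face of codimension `k` in the `l`-sphere. -/
def IsFaceOfCodim (k : ℕ) (F : Set (SphAmbient l)) : Prop :=
  ∃ d, d + k = l ∧ IsFaceOfDim 𝒜 d F

/-- The faces form a regular cell complex: the closure of each `d`-dimensional face is homeomorphic
to the closed `d`-ball, in such a way that the face corresponds to the open ball, and the rest of
the closure is covered by faces of smaller dimension. -/
def IsRegularCellDecomposition : Prop :=
  ∀ F, IsFace 𝒜 F → ∃ d, IsFaceOfDim 𝒜 d F ∧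
    (∃ e : Metric.closedBall (0 : EuclideanSpace ℝ (Fin d)) 1 ≃ₜ closure F,
      ∀ p, ((e p : SphAmbient l) ∈ F ↔ (p : EuclideanSpace ℝ (Fin d)) ∈ Metric.ball 0 1)) ∧
    ∀ x ∈ closure F \ F, ∃ d' < d, ∃ G, IsFaceOfDim 𝒜 d' G ∧ x ∈ G

end faces

end SphArr

/-- An arrangement of spheres in the unit sphere of dimension `l`. -/
structure SphereArrangement (l : ℕ) where
  /-- The hyperspheres of the arrangement. -/
  spheres : Set (Set (SphAmbient l))
  finite : spheres.Finite
  hypersphere : ∀ S ∈ spheres, SphArr.IsHypersphere l S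
  /-- All intersections are spheres of some dimension. -/
  inter_sphere : ∀ I ⊆ spheres, ∃ n, SphArr.IsSphereOfDimSucc n (SphArr.inter l I)
  /-- An intersection meets every sphere not containing it in a sphere of one dimension less. -/
  inter_hypersphere : ∀ I ⊆ spheres, ∀ S ∈ spheres, ¬ SphArr.inter l I ⊆ S →
    ∃ n, SphArr.IsSphereOfDimSucc (n + 1) (SphArr.inter l I) ∧
      SphArr.IsSphereOfDimSucc n (SphArr.inter l I ∩ S)
  regular : SphArr.IsRegularCellDecomposition spheres

namespace SphereArrangement

variable {l : ℕ} (A : SphereArrangement l)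

/-- Every hypersphere is cut out by a linear subspace of codimension one. -/
def CentrallySymmetric : Prop :=
  ∀ S ∈ A.spheres, ∃ H : Submodule ℝ (SphAmbient l),
    Module.finrank ℝ H = l ∧ S = (H : Set (SphAmbient l)) ∩ SphArr.unitSphere l

/-- Chambers are the faces of codimension zero. -/
def Chamber : Type := {C : Set (SphAmbient l) // SphArr.IsFaceOfCodim A.spheres 0 C}

variable {A}

/-- The set of points of a chamber. -/
def Chamber.carrier (C : A.Chamber) : Set (SphAmbient l) := C.1

/-- `S` separates `C` and `D`: they lie in distinct connected components of the complement of `S`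
in the unit sphere. -/
def Separates (S : Set (SphAmbient l)) (C D : A.Chamber) : Prop :=
  ∃ x ∈ SphArr.unitSphere l \ S, ∃ y ∈ SphArr.unitSphere l \ S,
    connectedComponentIn (SphArr.unitSphere l \ S) x ≠
      connectedComponentIn (SphArr.unitSphere l \ S) y ∧
    C.carrier ⊆ connectedComponentIn (SphArr.unitSphere l \ S) x ∧
    D.carrier ⊆ connectedComponentIn (SphArr.unitSphere l \ S) y

/-- The distance of two chambers: the number of hyperspheres of the arrangement that separate
them. -/
noncomputable def dist (C D : A.Chamber) : ℕ :=
  {S | S ∈ A.spheres ∧ Separates S C D}.ncard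

/-- `IsAct F C E` says that `E` is the chamber `F ∘ C`: among the chambers having `F` in their
closure, `E` is one at minimal distance from `C`. -/
def IsAct (F : Set (SphAmbient l)) (C E : A.Chamber) : Prop :=
  F ⊆ closure E.carrier ∧
    ∀ C' : A.Chamber, F ⊆ closure C'.carrier → dist C E ≤ dist C C'

variable (A)

/-- The `k`-cells `⟨F; C⟩` of the Salvetti complex: `F` is a face of codimension `k` and `C` is a
chamber whose closure contains `F`. -/
structure SalCell (k : ℕ) where
  /-- The face `F`. -/
  face : Set (SphAmbient l)
  /-- The chamber `C`. -/
  chamber : A.Chamber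
  isFace : SphArr.IsFaceOfCodim A.spheres k face
  subset : face ⊆ closure chamber.carrier

variable {A}

/-- `⟨F'; C'⟩` lies in the boundary of `⟨F; C⟩`: the dual cell of `F'` is properly contained in
that of `F`, and `C' = F' ∘ C`. -/
def SalCell.InBoundary {j k : ℕ} (c' : A.SalCell j) (c : A.SalCell k) : Prop :=
  c'.face ≠ c.face ∧ c.face ⊆ closure c'.face ∧ IsAct c'.face c.chamber c'.chamber

/-- A directed edge from `C` to `D` in the `1`-skeleton of the Salvetti complex: a `1`-cell
`⟨F; C⟩` such that `C` and `D` are the two vertices of the cell dual to `F`. -/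
structure SalEdge (C D : A.Chamber) where
  /-- The face of codimension one crossed by the edge. -/
  face : Set (SphAmbient l)
  isFace : SphArr.IsFaceOfCodim A.spheres 1 face
  subset_source : face ⊆ closure C.carrier
  subset_target : face ⊆ closure D.carrier
  ne : C ≠ D

/-- The `1`-cell `⟨F; C⟩` underlying a directed edge. -/
def SalEdge.cell {C D : A.Chamber} (e : SalEdge C D) : A.SalCell 1 :=
  ⟨e.face, C, e.isFace, e.subset_source⟩

/-- The oriented `1`-skeleton of the Salvetti complex; the vertex `⟨C; C⟩` is identified with the
chamber `C`. -/
instance : Quiver A.Chamber where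
  Hom C D := SalEdge C D

/-- Positive paths: sequences of consecutive edges, all traversed in the positive direction. -/
abbrev PosPath (C D : A.Chamber) : Type := Quiver.Path C D

/-- Edge paths in the `1`-skeleton, with edges traversed in either direction. -/
abbrev EdgePath (C D : A.Chamber) : Type :=
  Quiver.Path (V := Quiver.Symmetrify A.Chamber) C D

/-- A positive path is minimal if it has the least length among all edge paths with the same end
points. -/
def IsMinimal {C D : A.Chamber} (α : PosPath C D) : Prop :=
  ∀ β : EdgePath C D, α.length ≤ β.length

/-- All edges of the positive path lie in the boundary of the given `2`-cell. -/
def InBoundaryOf (c : A.SalCell 2) {C : A.Chamber} : {D : A.Chamber} → PosPath C D → Prop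
  | _, Quiver.Path.nil => True
  | _, Quiver.Path.cons p e => InBoundaryOf c p ∧ (SalEdge.cell e).InBoundary c

variable (A)

/-- Elementary substitution: two minimal positive paths with the same end points that run in the
boundary of a common `2`-cell of the Salvetti complex. -/
def elemRel : HomRel (Paths A.Chamber) := fun C D α β =>
  ∃ c : A.SalCell 2, IsMinimal (C := C) (D := D) α ∧ IsMinimal (C := C) (D := D) β ∧
    InBoundaryOf c (C := C) (D := D) α ∧ InBoundaryOf c (C := C) (D := D) β

/-- The positive category: its objects are the vertices of the Salvetti complex and its morphisms
are the positive paths up to sequences of elementary substitutions inside paths (directed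
homotopy). -/
abbrev PosCat : Type := CategoryTheory.Quotient A.elemRel

/-- The arrangement groupoid: the category of fractions of the positive category, obtained by
formally inverting all morphisms. It is the edge-path groupoid of the Salvetti complex. -/
abbrev ArrGroupoid : Type := CategoryTheory.FreeGroupoid A.PosCat

/-- The canonical functor from the positive category to the arrangement groupoid. -/
noncomputable abbrev J : A.PosCat ⥤ A.ArrGroupoid := CategoryTheory.FreeGroupoid.of A.PosCat

variable {A}

/-- The vertex `C` as an object of the positive category. -/
abbrev vertex (C : A.Chamber) : A.PosCat :=
  (CategoryTheory.Quotient.functor A.elemRel).obj ((Paths.of A.Chamber).obj C)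

/-- The class of a positive path in the positive category. -/
abbrev posClass {C D : A.Chamber} (α : PosPath C D) : vertex C ⟶ vertex D :=
  (CategoryTheory.Quotient.functor A.elemRel).map
    (X := (Paths.of A.Chamber).obj C) (Y := (Paths.of A.Chamber).obj D) α

end SphereArrangement

/-! Both claims reduce to the second one: any two minimal positive paths with common ends are
positively equivalent, which makes faithfulness immediate. Linear functionals cutting out the
hyperspheres turn chambers into sign vectors, and a minimal positive path from `C` to `D` is one
crossing each separating hypersphere exactly once.

The proof is by induction on the number of separating hyperspheres (`posClass_eq_of_geodesic`). Let
two geodesics end with edges from `D₁` and `D₂` to `D`. Join points of the two faces crossed by a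
segment; apart from its ends it runs in the open cone over `D`. From each point of the segment shoot
a ray in a generic direction `y` taken from `C`, and record the set of hyperspheres where it leaves
the closed cone over `D` (`exits`). The segment spans at most a plane, so genericity puts the exit
point in a flat of codimension at most two (`exists_generic_direction`). Reflecting the signs of `D`
in the recorded hyperspheres gives a chamber `E` between `C` and `D` (`exists_chamber_flip`), and
geodesics from `E` to `D` agree up to one elementary substitution.

By induction the class of a geodesic from `C` through `E` to `D` depends only on the point of the
segment. It is locally constant because the exit set can only shrink near a given point
(`eventually_exits_subset`), so it is constant on the segment. At the two ends `E` is `D₁` and `D₂`,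
and the given paths are compared. -/

namespace SphArr

open Filter Topology Module

/-! ### Sign cells of a family of linear functionals. -/

section signCell

variable {ι E : Type*} [NormedAddCommGroup E] [NormedSpace ℝ E]

/-- The unit vectors on which a family of functionals has the same signs as at `x`. -/
def signCell (a : ι → E →L[ℝ] ℝ) (x : E) : Set E :=
  {y | y ∈ Metric.sphere (0 : E) 1 ∧ ∀ i, SignType.sign (a i y) = SignType.sign (a i x)}

theorem mem_signCell_self {a : ι → E →L[ℝ] ℝ} {x : E} (hx : x ∈ Metric.sphere (0 : E) 1) :
    x ∈ signCell a x :=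
  ⟨hx, fun _ => rfl⟩

/-- The intersection of the kernels of those functionals that vanish at `x`. -/
def flat (a : ι → E →L[ℝ] ℝ) (x : E) : Submodule ℝ E :=
  ⨅ (i : ι) (_ : a i x = 0), LinearMap.ker (a i : E →ₗ[ℝ] ℝ)

theorem mem_flat {a : ι → E →L[ℝ] ℝ} {x v : E} : v ∈ flat a x ↔ ∀ i, a i x = 0 → a i v = 0 := by
  simp [flat, Submodule.mem_iInf]

theorem sign_smul_of_pos (f : E →L[ℝ] ℝ) {c : ℝ} (hc : 0 < c) (v : E) :
    SignType.sign (f (c • v)) = SignType.sign (f v) := by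
  rw [map_smul, smul_eq_mul, sign_mul, sign_pos hc, one_mul]

theorem sign_apply_segment (f : E →L[ℝ] ℝ) {x y z : E}
    (h : SignType.sign (f y) = SignType.sign (f x)) (hz : z ∈ segment ℝ x y) :
    SignType.sign (f z) = SignType.sign (f x) := by
  obtain ⟨s, t, hs, ht, hst, rfl⟩ := hz
  simp only [map_add, map_smul, smul_eq_mul]
  rcases lt_trichotomy (f x) 0 with hx | hx | hx
  · rw [sign_neg hx, sign_eq_neg_one_iff] at h
    rw [sign_neg hx, sign_eq_neg_one_iff]
    rcases hs.eq_or_lt with rfl | hs'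
    · have : t = 1 := by linarith
      subst this; linarith
    · nlinarith [mul_neg_of_pos_of_neg hs' hx, mul_nonneg ht (neg_nonneg.2 h.le)]
  · rw [hx, sign_zero, sign_eq_zero_iff] at h
    simp [hx, h]
  · rw [sign_pos hx, sign_eq_one_iff] at h
    rw [sign_pos hx, sign_eq_one_iff]
    rcases hs.eq_or_lt with rfl | hs'
    · have : t = 1 := by linarith
      subst this; linarith
    · nlinarith [mul_pos hs' hx, mul_nonneg ht h.le]

theorem norm_inv_smul_mem_sphere {v : E} (hv : v ≠ 0) : ‖v‖⁻¹ • v ∈ Metric.sphere (0 : E) 1 := by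
  rw [mem_sphere_zero_iff_norm, norm_smul, norm_inv, norm_norm,
    inv_mul_cancel₀ (norm_ne_zero_iff.2 hv)]

theorem sign_normalize (f : E →L[ℝ] ℝ) {v : E} (hv : v ≠ 0) :
    SignType.sign (f (‖v‖⁻¹ • v)) = SignType.sign (f v) :=
  sign_smul_of_pos f (inv_pos.2 (norm_pos_iff.2 hv)) v

/-- A functional that is nonzero at `x` keeps its sign along a segment to any other point of the
cell. The segment therefore misses the origin and projects radially into the cell. -/
theorem isPreconnected_signCell_of_ne {a : ι → E →L[ℝ] ℝ} {x : E}
    (hx : x ∈ Metric.sphere (0 : E) 1) {i : ι} (hi : a i x ≠ 0) :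
    IsPreconnected (signCell a x) := by
  refine isPreconnected_of_forall x fun y hy => ?_
  have hsgn : ∀ v ∈ segment ℝ x y, ∀ j, SignType.sign (a j v) = SignType.sign (a j x) :=
    fun v hv j => sign_apply_segment (a j) (hy.2 j) hv
  have hne : ∀ v ∈ segment ℝ x y, v ≠ 0 := by
    rintro v hv rfl
    have := hsgn 0 hv i
    rw [map_zero, sign_zero, eq_comm, sign_eq_zero_iff] at this
    exact hi this
  refine ⟨(fun v => ‖v‖⁻¹ • v) '' segment ℝ x y, ?_, ?_, ?_, ?_⟩
  · rintro _ ⟨v, hv, rfl⟩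
    exact ⟨norm_inv_smul_mem_sphere (hne v hv), fun j => by
      simp only
      rw [sign_normalize (a j) (hne v hv), hsgn v hv j]⟩
  · refine ⟨x, left_mem_segment ℝ x y, ?_⟩
    simp [mem_sphere_zero_iff_norm.1 hx]
  · refine ⟨y, right_mem_segment ℝ x y, ?_⟩
    simp [mem_sphere_zero_iff_norm.1 hy.1]
  · refine (convex_segment x y).isPreconnected.image _ ?_
    refine ContinuousOn.smul (ContinuousOn.inv₀ continuous_norm.continuousOn ?_) continuousOn_id
    exact fun v hv => norm_ne_zero_iff.2 (hne v hv)

theorem isPreconnected_inter_sphere (K : Submodule ℝ E) (hK : 2 ≤ finrank ℝ K) :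
    IsPreconnected ((K : Set E) ∩ Metric.sphere (0 : E) 1) := by
  have h1 : 1 < Module.rank ℝ K := by
    have : FiniteDimensional ℝ K := FiniteDimensional.of_finrank_pos (by omega)
    rw [← finrank_eq_rank]
    exact_mod_cast hK
  have := (isPreconnected_sphere h1 (0 : K) 1).image _ K.subtypeL.continuous.continuousOn
  convert this using 1
  ext v
  constructor
  · rintro ⟨hv, hv1⟩
    exact ⟨⟨v, hv⟩, by simpa using hv1, rfl⟩
  · rintro ⟨w, hw, rfl⟩
    exact ⟨w.2, by simpa using hw⟩

theorem isPreconnected_signCell {a : ι → E →L[ℝ] ℝ} {x : E}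
    (hx : x ∈ Metric.sphere (0 : E) 1) (h : 2 ≤ finrank ℝ (flat a x)) :
    IsPreconnected (signCell a x) := by
  by_cases h0 : ∃ i, a i x ≠ 0
  · obtain ⟨i, hi⟩ := h0
    exact isPreconnected_signCell_of_ne hx hi
  · push Not at h0
    convert isPreconnected_inter_sphere _ h using 1
    ext v
    simp [signCell, mem_flat, h0, and_comm]

/-- Composition of sign vectors: a small move from `z` along `v` keeps the nonzero signs and fills
the zeros with the signs of `v`. This yields both closure relations and new chambers. -/
theorem eventually_sign_add_smul [Finite ι] (a : ι → E →L[ℝ] ℝ) (z v : E) :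
    ∀ᶠ ε in 𝓝[>] (0 : ℝ), ∀ i,
      (a i z = 0 → SignType.sign (a i (z + ε • v)) = SignType.sign (a i v)) ∧
      (a i z ≠ 0 → SignType.sign (a i (z + ε • v)) = SignType.sign (a i z)) := by
  rw [eventually_all]
  intro i
  by_cases hz : a i z = 0
  · filter_upwards [self_mem_nhdsWithin] with ε hε
    refine ⟨fun _ => ?_, fun h => absurd hz h⟩
    rw [map_add, hz, zero_add, sign_smul_of_pos _ hε]
  · have hc : Continuous fun ε : ℝ => a i (z + ε • v) := by fun_prop
    have h0 : (fun ε : ℝ => a i (z + ε • v)) 0 = a i z := by simp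
    rcases lt_or_gt_of_ne hz with h | h
    · have : ∀ᶠ ε in 𝓝 (0 : ℝ), a i (z + ε • v) < 0 :=
        hc.continuousAt.eventually (gt_mem_nhds (by simpa using h))
      filter_upwards [nhdsWithin_le_nhds this] with ε hε
      exact ⟨fun h' => absurd h' hz, fun _ => by rw [sign_neg hε, sign_neg h]⟩
    · have : ∀ᶠ ε in 𝓝 (0 : ℝ), 0 < a i (z + ε • v) :=
        hc.continuousAt.eventually (lt_mem_nhds (by simpa using h))
      filter_upwards [nhdsWithin_le_nhds this] with ε hε
      exact ⟨fun h' => absurd h' hz, fun _ => by rw [sign_pos hε, sign_pos h]⟩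

theorem signCell_subset_closure [Finite ι] {a : ι → E →L[ℝ] ℝ} {z x : E}
    (h : ∀ i, a i z ≠ 0 → SignType.sign (a i z) = SignType.sign (a i x)) :
    signCell a z ⊆ closure (signCell a x) := by
  intro w hw
  have hw0 : w ≠ 0 := ne_zero_of_mem_unit_sphere ⟨w, hw.1⟩
  have hne : ∀ᶠ ε in 𝓝[>] (0 : ℝ), w + ε • x ≠ 0 := by
    have hc : Continuous fun ε : ℝ => w + ε • x := by fun_prop
    exact nhdsWithin_le_nhds (hc.continuousAt.eventually_ne (by simpa using hw0))
  have hlim : Tendsto (fun ε : ℝ => ‖w + ε • x‖⁻¹ • (w + ε • x)) (𝓝[>] 0) (𝓝 w) := by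
    have hc : ContinuousAt (fun ε : ℝ => ‖w + ε • x‖⁻¹ • (w + ε • x)) 0 := by
      refine ContinuousAt.smul (ContinuousAt.inv₀ (by fun_prop) (by simpa using hw0))
        (by fun_prop)
    have := hc.tendsto
    simp only [zero_smul, add_zero, mem_sphere_zero_iff_norm.1 hw.1, inv_one, one_smul] at this
    exact this.mono_left nhdsWithin_le_nhds
  refine mem_closure_of_tendsto hlim ?_
  filter_upwards [hne, eventually_sign_add_smul a w x] with ε hε hs
  refine ⟨norm_inv_smul_mem_sphere hε, fun i => ?_⟩
  rw [sign_normalize _ hε]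
  by_cases hi : a i w = 0
  · exact (hs i).1 hi
  · rw [(hs i).2 hi, hw.2 i]
    refine h i fun hz => hi ?_
    have := hw.2 i
    rwa [hz, sign_zero, sign_eq_zero_iff] at this

theorem sign_eq_of_mem_closure_signCell {a : ι → E →L[ℝ] ℝ} {y x : E}
    (hy : y ∈ closure (signCell a x)) {i : ι} (hi : a i y ≠ 0) :
    SignType.sign (a i y) = SignType.sign (a i x) := by
  rcases lt_or_gt_of_ne hi with h | h
  · obtain ⟨w, hw, hwx⟩ := mem_closure_iff.1 hy _ (isOpen_Iio.preimage (a i).continuous) h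
    rw [← hwx.2 i, sign_neg h, sign_neg hw]
  · obtain ⟨w, hw, hwx⟩ := mem_closure_iff.1 hy _ (isOpen_Ioi.preimage (a i).continuous) h
    rw [← hwx.2 i, sign_pos h, sign_pos hw]

theorem signCell_congr {a : ι → E →L[ℝ] ℝ} {x y : E}
    (h : ∀ i, SignType.sign (a i x) = SignType.sign (a i y)) : signCell a x = signCell a y := by
  ext; simp [signCell, h]

theorem flat_congr {a : ι → E →L[ℝ] ℝ} {x y : E}
    (h : ∀ i, a i x = 0 ↔ a i y = 0) : flat a x = flat a y := by
  simp [flat, h]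

/-- On a preconnected set a continuous functional without zeros has constant sign. -/
theorem sign_eq_of_isPreconnected {s : Set E} (hs : IsPreconnected s) (f : E →L[ℝ] ℝ)
    (hf : ∀ y ∈ s, f y ≠ 0) {x y : E} (hx : x ∈ s) (hy : y ∈ s) :
    SignType.sign (f y) = SignType.sign (f x) := by
  have hoc := (hs.image f f.continuous.continuousOn).ordConnected
  have h0 : (0 : ℝ) ∉ f '' s := by
    rintro ⟨v, hv, h⟩
    exact hf v hv h
  have fx := Set.mem_image_of_mem f hx
  have fy := Set.mem_image_of_mem f hy
  rcases lt_or_gt_of_ne (hf x hx) with h1 | h1 <;> rcases lt_or_gt_of_ne (hf y hy) with h2 | h2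
  · rw [sign_neg h1, sign_neg h2]
  · exact absurd (hoc.out fx fy ⟨h1.le, h2.le⟩) h0
  · exact absurd (hoc.out fy fx ⟨h2.le, h1.le⟩) h0
  · rw [sign_pos h1, sign_pos h2]

end signCell

/-! ### The dimension of a round sphere. -/

section spheres

variable {l : ℕ}

/-- Differences of antipodal points give every direction. Hence a sphere determines its dimension,
and codimensions of faces become ranks of flats. -/
theorem vectorSpan_inter_sphere {P : AffineSubspace ℝ (SphAmbient l)} {c : SphAmbient l} {r : ℝ}
    (hc : c ∈ P) (hr : 0 < r) :
    vectorSpan ℝ ((P : Set (SphAmbient l)) ∩ Metric.sphere c r) = P.direction := by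
  apply le_antisymm
  · exact (vectorSpan_mono ℝ Set.inter_subset_left).trans_eq
      (by rw [← direction_affineSpan, AffineSubspace.affineSpan_coe])
  · intro v hv
    by_cases hv0 : v = 0
    · subst hv0; exact Submodule.zero_mem _
    have hn : 0 < ‖v‖ := norm_pos_iff.2 hv0
    have key : ∀ t : ℝ, |t| * ‖v‖ = r →
        c + t • v ∈ (P : Set (SphAmbient l)) ∩ Metric.sphere c r := by
      intro t ht
      constructor
      · have := AffineSubspace.vadd_mem_of_mem_direction (P.direction.smul_mem t hv) hc
        simpa only [vadd_eq_add, add_comm, SetLike.mem_coe] using this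
      · simpa [norm_smul] using ht
    have ht : 0 < r / ‖v‖ := div_pos hr hn
    have h1 := key (r / ‖v‖) (by rw [abs_of_pos ht]; field_simp)
    have h2 := key (-(r / ‖v‖)) (by rw [abs_neg, abs_of_pos ht]; field_simp)
    have h3 := vsub_mem_vectorSpan ℝ h1 h2
    have h4 : (c + (r / ‖v‖) • v) -ᵥ (c + (-(r / ‖v‖)) • v) = (2 * (r / ‖v‖)) • v := by
      rw [vsub_eq_sub]; module
    rw [h4] at h3
    exact (Submodule.smul_mem_iff _ (by positivity)).1 h3

theorem isSphereOfDimSucc_inter_unitSphere_iff {n : ℕ} (K : Submodule ℝ (SphAmbient l)) :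
    IsSphereOfDimSucc n ((K : Set (SphAmbient l)) ∩ unitSphere l) ↔ finrank ℝ K = n := by
  have hK : vectorSpan ℝ ((K : Set (SphAmbient l)) ∩ unitSphere l) = K := by
    have := vectorSpan_inter_sphere (P := K.toAffineSubspace) (c := 0) (r := 1)
      K.zero_mem one_pos
    rwa [Submodule.toAffineSubspace_direction] at this
  constructor
  · rintro ⟨P, c, r, hc, hr, hP, h⟩
    rw [← hP, ← vectorSpan_inter_sphere hc hr, ← h, hK]
  · rintro h
    exact ⟨K.toAffineSubspace, 0, 1, K.zero_mem, one_pos,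
      by rwa [Submodule.toAffineSubspace_direction], rfl⟩

end spheres

end SphArr

/-! ### Faces and chambers in terms of defining functionals. -/

namespace SphereArrangement

open Filter Topology Module SphArr

variable {l : ℕ} {A : SphereArrangement l}

/-- A family of linear functionals whose kernels cut out the members of the arrangement. -/
def IsDefining (a : A.spheres → SphAmbient l →L[ℝ] ℝ) : Prop :=
  ∀ S, a S ≠ 0 ∧ (S : Set (SphAmbient l)) = {x | a S x = 0} ∩ unitSphere l

theorem CentrallySymmetric.exists_isDefining (hA : A.CentrallySymmetric) :
    ∃ a : A.spheres → SphAmbient l →L[ℝ] ℝ, IsDefining a := by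
  have key : ∀ S : A.spheres, ∃ f : SphAmbient l →L[ℝ] ℝ,
      f ≠ 0 ∧ (S : Set (SphAmbient l)) = {x | f x = 0} ∩ unitSphere l := by
    rintro ⟨S, hS⟩
    obtain ⟨H, hH, rfl⟩ := hA S hS
    have h1 : finrank ℝ Hᗮ = 1 := by
      have := H.finrank_add_finrank_orthogonal
      rw [hH, finrank_euclideanSpace_fin] at this
      omega
    obtain ⟨n, hn, hspan⟩ := finrank_eq_one_iff'.1 h1
    refine ⟨innerSL ℝ (n : SphAmbient l), ?_, ?_⟩
    · intro h
      have := congrArg (fun f => f (n : SphAmbient l)) h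
      simp at this
      exact hn this
    · suffices h : ∀ x, x ∈ H ↔ inner ℝ (n : SphAmbient l) x = 0 by
        ext x
        exact and_congr_left fun _ => h x
      intro x
      conv_lhs => rw [← H.orthogonal_orthogonal, Submodule.mem_orthogonal]
      constructor
      · exact fun h => h n n.2
      · intro h u hu
        obtain ⟨c, hc⟩ := hspan ⟨u, hu⟩
        have : u = c • (n : SphAmbient l) := by simpa using (congrArg Subtype.val hc).symm
        rw [this, inner_smul_left, h, mul_zero]
  choose a ha using key
  exact ⟨a, ha⟩

theorem mem_stratum_self {𝒜 : Set (Set (SphAmbient l))} {x : SphAmbient l}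
    (hx : x ∈ unitSphere l) : x ∈ stratum 𝒜 x :=
  ⟨hx, fun _ _ => Iff.rfl⟩

namespace IsDefining

variable {a : A.spheres → SphAmbient l →L[ℝ] ℝ} (ha : IsDefining a)
include ha

theorem mem_iff {x : SphAmbient l} (hx : x ∈ unitSphere l) (S : A.spheres) :
    x ∈ (S : Set (SphAmbient l)) ↔ a S x = 0 := by
  rw [(ha S).2]
  exact ⟨fun h => h.1, fun h => ⟨h, hx⟩⟩

theorem finrank_ker (S : A.spheres) :
    finrank ℝ (LinearMap.ker (a S : SphAmbient l →ₗ[ℝ] ℝ)) = l := by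
  have h := LinearMap.finrank_range_add_finrank_ker (a S : SphAmbient l →ₗ[ℝ] ℝ)
  have h2 : LinearMap.range (a S : SphAmbient l →ₗ[ℝ] ℝ) = ⊤ :=
    LinearMap.range_eq_top.2 (LinearMap.surjective fun h => (ha S).1 (by
      ext x; exact congrArg (fun f => f x) h))
  rw [h2, finrank_top, finrank_self, finrank_euclideanSpace_fin] at h
  omega

theorem eq_of_ker_eq {S T : A.spheres}
    (h : LinearMap.ker (a S : SphAmbient l →ₗ[ℝ] ℝ) = LinearMap.ker (a T : SphAmbient l →ₗ[ℝ] ℝ)) :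
    S = T := by
  apply Subtype.ext
  rw [(ha S).2, (ha T).2]
  congr 1
  ext x
  have : x ∈ LinearMap.ker (a S : SphAmbient l →ₗ[ℝ] ℝ) ↔
    x ∈ LinearMap.ker (a T : SphAmbient l →ₗ[ℝ] ℝ) := by rw [h]
  simpa using this

theorem face_subset_signCell {x : SphAmbient l} (hx : x ∈ unitSphere l) :
    connectedComponentIn (stratum A.spheres x) x ⊆ signCell a x := by
  intro y hy
  have hsub := connectedComponentIn_subset (stratum A.spheres x) x
  refine ⟨(hsub hy).1, fun S => ?_⟩
  by_cases h0 : a S x = 0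
  · have := ((hsub hy).2 S S.2).2 ((ha.mem_iff hx S).2 h0)
    rw [(ha.mem_iff (hsub hy).1 S).1 this, h0]
  · refine sign_eq_of_isPreconnected isPreconnected_connectedComponentIn (a S) ?_
      (mem_connectedComponentIn (mem_stratum_self hx)) hy
    intro z hz hz0
    exact h0 ((ha.mem_iff hx S).1 (((hsub hz).2 S S.2).1 ((ha.mem_iff (hsub hz).1 S).2 hz0)))

theorem signCell_subset_stratum {x : SphAmbient l} (hx : x ∈ unitSphere l) :
    signCell a x ⊆ stratum A.spheres x := by
  refine fun y hy => ⟨hy.1, fun S hS => ?_⟩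
  rw [ha.mem_iff hy.1 ⟨S, hS⟩, ha.mem_iff hx ⟨S, hS⟩, ← sign_eq_zero_iff, hy.2, sign_eq_zero_iff]

/-- The rank bound excludes a cell that is a pair of antipodal points, which has two components.
This can occur for faces of codimension two when `l = 2`; for codimension two only the inclusion
`face_subset_signCell` is used. -/
theorem face_eq_signCell {x : SphAmbient l} (hx : x ∈ unitSphere l)
    (h : 2 ≤ finrank ℝ (flat a x)) :
    connectedComponentIn (stratum A.spheres x) x = signCell a x :=
  (ha.face_subset_signCell hx).antisymm ((isPreconnected_signCell hx h).subset_connectedComponentIn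
    (mem_signCell_self hx) (ha.signCell_subset_stratum hx))

theorem support_face {x : SphAmbient l} (hx : x ∈ unitSphere l) :
    support A.spheres (connectedComponentIn (stratum A.spheres x) x) =
      (flat a x : Set (SphAmbient l)) ∩ unitSphere l := by
  have key : ∀ S : A.spheres, connectedComponentIn (stratum A.spheres x) x ⊆ (S : Set _) ↔
      a S x = 0 := by
    intro S
    constructor
    · intro h
      exact (ha.mem_iff hx S).1 (h (mem_connectedComponentIn (mem_stratum_self hx)))
    · intro h y hy
      have := ha.face_subset_signCell hx hy
      rw [ha.mem_iff this.1, ← sign_eq_zero_iff, this.2, h, sign_zero]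
  ext y
  constructor
  · rintro ⟨hy, h⟩
    refine ⟨mem_flat.2 fun S hS => ?_, hy⟩
    exact (ha.mem_iff hy S).1 (h S ⟨S.2, (key S).2 hS⟩)
  · rintro ⟨h, hy⟩
    refine ⟨hy, fun S hS => ?_⟩
    exact (ha.mem_iff hy ⟨S, hS.1⟩).2 (mem_flat.1 h ⟨S, hS.1⟩ ((key ⟨S, hS.1⟩).1 hS.2))

theorem isFaceOfCodim_iff {x : SphAmbient l} (hx : x ∈ unitSphere l) (k : ℕ) :
    IsFaceOfCodim A.spheres k (connectedComponentIn (stratum A.spheres x) x) ↔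
      k ≤ l ∧ finrank ℝ (flat a x) + k = l + 1 := by
  simp only [IsFaceOfCodim, IsFaceOfDim, ha.support_face hx,
    isSphereOfDimSucc_inter_unitSphere_iff]
  constructor
  · rintro ⟨d, hd, -, h⟩
    omega
  · rintro ⟨hk, h⟩
    exact ⟨l - k, by omega, ⟨x, hx, rfl⟩, by omega⟩

theorem exists_eq_signCell {k : ℕ} (hk : k < l) {F : Set (SphAmbient l)}
    (hF : IsFaceOfCodim A.spheres k F) :
    ∃ x ∈ unitSphere l, F = signCell a x ∧ finrank ℝ (flat a x) + k = l + 1 := by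
  obtain ⟨x, hx, rfl⟩ := hF.choose_spec.2.1
  have h := ((ha.isFaceOfCodim_iff hx k).1 hF).2
  exact ⟨x, hx, ha.face_eq_signCell hx (by omega), h⟩

theorem ne_zero_of_finrank_flat {x : SphAmbient l} (h : finrank ℝ (flat a x) = l + 1)
    (S : A.spheres) : a S x ≠ 0 := by
  intro h0
  have : flat a x ≤ LinearMap.ker (a S : SphAmbient l →ₗ[ℝ] ℝ) :=
    fun v hv => mem_flat.1 hv S h0
  have := Submodule.finrank_mono this
  rw [h, ha.finrank_ker] at this
  omega

omit ha in
theorem finrank_flat_of_ne_zero {x : SphAmbient l} (h : ∀ S, a S x ≠ 0) :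
    finrank ℝ (flat a x) = l + 1 := by
  have : flat a x = ⊤ := by
    rw [eq_top_iff]
    exact fun v _ => mem_flat.2 fun S hS => absurd hS (h S)
  rw [this, finrank_top, finrank_euclideanSpace_fin]

theorem existsUnique_of_finrank_flat {x : SphAmbient l} (h : finrank ℝ (flat a x) = l) :
    ∃ S, ∀ T, a T x = 0 ↔ T = S := by
  have hex : ∃ S, a S x = 0 := by
    by_contra! hne
    have := finrank_flat_of_ne_zero hne
    omega
  have hker : ∀ S, a S x = 0 → flat a x = LinearMap.ker (a S : SphAmbient l →ₗ[ℝ] ℝ) := by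
    intro S hS
    exact Submodule.eq_of_le_of_finrank_eq (fun v hv => mem_flat.1 hv S hS)
      (by rw [h, ha.finrank_ker])
  obtain ⟨S, hS⟩ := hex
  refine ⟨S, fun T => ⟨fun hT => ?_, fun hT => hT ▸ hS⟩⟩
  exact ha.eq_of_ker_eq ((hker T hT).symm.trans (hker S hS))

theorem finrank_flat_of_forall_iff {x : SphAmbient l} {S : A.spheres}
    (h : ∀ T, a T x = 0 ↔ T = S) : finrank ℝ (flat a x) = l := by
  have : flat a x = LinearMap.ker (a S : SphAmbient l →ₗ[ℝ] ℝ) := by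
    ext v
    simp [mem_flat, h]
  rw [this, ha.finrank_ker]

end IsDefining

/-- A point of a chamber. -/
noncomputable def Chamber.point (C : A.Chamber) : SphAmbient l := C.2.choose_spec.2.1.choose

theorem Chamber.point_mem (C : A.Chamber) : C.point ∈ unitSphere l :=
  C.2.choose_spec.2.1.choose_spec.1

theorem Chamber.carrier_eq (C : A.Chamber) :
    C.carrier = connectedComponentIn (stratum A.spheres C.point) C.point :=
  C.2.choose_spec.2.1.choose_spec.2

/-- The members of the arrangement on which two chambers have different signs. -/
def sep (a : A.spheres → SphAmbient l →L[ℝ] ℝ) (C D : A.Chamber) : Set A.spheres :=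
  {S | SignType.sign (a S C.point) ≠ SignType.sign (a S D.point)}

instance : Finite A.spheres := A.finite

namespace IsDefining

variable {a : A.spheres → SphAmbient l →L[ℝ] ℝ} (ha : IsDefining a)
include ha

theorem point_ne_zero (C : A.Chamber) (S : A.spheres) : a S C.point ≠ 0 := by
  have h := C.2
  change IsFaceOfCodim A.spheres 0 C.carrier at h
  rw [C.carrier_eq, ha.isFaceOfCodim_iff C.point_mem] at h
  exact ha.ne_zero_of_finrank_flat h.2 S

theorem carrier_eq_signCell (hl : 1 ≤ l) (C : A.Chamber) : C.carrier = signCell a C.point := by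
  rw [C.carrier_eq]
  refine ha.face_eq_signCell C.point_mem ?_
  rw [finrank_flat_of_ne_zero (ha.point_ne_zero C)]
  omega

theorem chamber_ext (hl : 1 ≤ l) {C D : A.Chamber} (h : sep a C D = ∅) : C = D := by
  apply Subtype.ext
  change C.carrier = D.carrier
  rw [ha.carrier_eq_signCell hl, ha.carrier_eq_signCell hl]
  refine signCell_congr fun S => ?_
  by_contra hS
  exact (Set.eq_empty_iff_forall_notMem.1 h S) hS

theorem exists_chamber (hl : 1 ≤ l) {w : SphAmbient l} (hw0 : w ≠ 0) (hw : ∀ S, a S w ≠ 0) :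
    ∃ E : A.Chamber, ∀ S, SignType.sign (a S E.point) = SignType.sign (a S w) := by
  have hu : ‖w‖⁻¹ • w ∈ unitSphere l := norm_inv_smul_mem_sphere hw0
  have hne : ∀ S, a S (‖w‖⁻¹ • w) ≠ 0 := fun S => by
    rw [← sign_ne_zero, sign_normalize _ hw0, sign_ne_zero]
    exact hw S
  let E : A.Chamber := ⟨_, (ha.isFaceOfCodim_iff hu 0).2
    ⟨by omega, finrank_flat_of_ne_zero hne⟩⟩
  have hE : E.point ∈ signCell a (‖w‖⁻¹ • w) := by
    refine ha.face_subset_signCell hu ?_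
    change E.point ∈ E.carrier
    rw [E.carrier_eq]
    exact mem_connectedComponentIn (mem_stratum_self E.point_mem)
  exact ⟨E, fun S => by rw [hE.2 S, sign_normalize _ hw0]⟩

end IsDefining

/-! ### Separating sets and the distance of chambers. -/

section sep

variable (a : A.spheres → SphAmbient l →L[ℝ] ℝ)

theorem sep_comm (C D : A.Chamber) : sep a C D = sep a D C := by
  ext S; simp [sep, ne_comm]

theorem sep_self (C : A.Chamber) : sep a C C = ∅ := by
  ext S; simp [sep]

variable {a}

theorem notMem_sep {C D : A.Chamber} {S : A.spheres} :
    S ∉ sep a C D ↔ SignType.sign (a S C.point) = SignType.sign (a S D.point) := by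
  simp [sep]

theorem sep_subset_union (C D E : A.Chamber) : sep a C E ⊆ sep a C D ∪ sep a D E := by
  intro S hS
  by_contra h
  rw [Set.mem_union, not_or, notMem_sep, notMem_sep] at h
  exact hS (h.1.trans h.2)

/-- No functional vanishes on a chamber, so signs take only two values and two changes cancel. -/
theorem IsDefining.sep_eq_symmDiff (ha : IsDefining a) (C D E : A.Chamber) :
    sep a C E = symmDiff (sep a C D) (sep a D E) := by
  ext S
  have hC := sign_ne_zero.2 (ha.point_ne_zero C S)
  have hD := sign_ne_zero.2 (ha.point_ne_zero D S)
  have hE := sign_ne_zero.2 (ha.point_ne_zero E S)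
  simp only [sep, Set.mem_symmDiff, Set.mem_ofPred_eq]
  generalize SignType.sign (a S C.point) = c at *
  generalize SignType.sign (a S D.point) = d at *
  generalize SignType.sign (a S E.point) = e at *
  revert c d e; decide

/-- If every hypersphere separating `E` from `D` separates `C` from `D`, then `E` lies between
`C` and `D`. -/
theorem IsDefining.ncard_sep_of_subset (ha : IsDefining a) {C D E : A.Chamber}
    (h : sep a E D ⊆ sep a C D) :
    (sep a C D).ncard = (sep a C E).ncard + (sep a E D).ncard := by
  have h1 : sep a C E = sep a C D \ sep a E D := by
    rw [ha.sep_eq_symmDiff C D E, sep_comm a D E, Set.symmDiff_def,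
      Set.sdiff_eq_empty.2 h, Set.union_empty]
  rw [h1, Set.ncard_sdiff_add_ncard_of_subset h]

/-- A hypersphere separates two chambers iff its functional has different signs on them. -/
theorem IsDefining.separates_iff (ha : IsDefining a) (hl : 1 ≤ l) (C D : A.Chamber)
    (S : A.spheres) : Separates (S : Set (SphAmbient l)) C D ↔ S ∈ sep a C D := by
  have hdiff : ∀ x, x ∈ unitSphere l \ (S : Set (SphAmbient l)) ↔ x ∈ unitSphere l ∧ a S x ≠ 0 :=
    fun x => ⟨fun h => ⟨h.1, fun h' => h.2 ((ha.mem_iff h.1 S).2 h')⟩,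
      fun h => ⟨h.1, fun h' => h.2 ((ha.mem_iff h.1 S).1 h')⟩⟩
  have hsub : ∀ {x}, x ∈ unitSphere l \ (S : Set (SphAmbient l)) →
      connectedComponentIn (unitSphere l \ (S : Set (SphAmbient l))) x =
        signCell (fun _ : Unit => a S) x := by
    intro x hx
    have hx' := (hdiff x).1 hx
    apply subset_antisymm
    · intro y hy
      have hs := connectedComponentIn_subset _ _ hy
      refine ⟨hs.1, fun _ => ?_⟩
      refine sign_eq_of_isPreconnected isPreconnected_connectedComponentIn (a S) ?_
        (mem_connectedComponentIn hx) hy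
      exact fun z hz => ((hdiff z).1 (connectedComponentIn_subset _ _ hz)).2
    · refine IsPreconnected.subset_connectedComponentIn
        (isPreconnected_signCell_of_ne hx'.1 (i := ()) hx'.2) ⟨hx'.1, fun _ => rfl⟩ ?_
      intro y hy
      exact (hdiff y).2 ⟨hy.1, by rw [← sign_ne_zero, hy.2 (), sign_ne_zero]; exact hx'.2⟩
  have hpt : ∀ C : A.Chamber, C.point ∈ unitSphere l \ (S : Set (SphAmbient l)) :=
    fun C => (hdiff _).2 ⟨C.point_mem, ha.point_ne_zero C S⟩
  have hmem : ∀ C : A.Chamber, C.point ∈ C.carrier := fun C => by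
    rw [ha.carrier_eq_signCell hl]
    exact ⟨C.point_mem, fun _ => rfl⟩
  constructor
  · rintro ⟨x, hx, y, hy, hne, hC, hD⟩ heq
    rw [hsub hx] at hne hC
    rw [hsub hy] at hne hD
    refine hne (signCell_congr fun i => ?_)
    rw [← (hC (hmem C)).2 i, ← (hD (hmem D)).2 i]
    exact heq
  · intro h
    refine ⟨C.point, hpt C, D.point, hpt D, ?_, ?_, ?_⟩
    · rw [hsub (hpt C), hsub (hpt D)]
      intro heq
      have : C.point ∈ signCell (fun _ : Unit => a S) D.point := heq ▸ ⟨C.point_mem, fun _ => rfl⟩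
      exact h (this.2 ())
    · rw [hsub (hpt C), ha.carrier_eq_signCell hl]
      exact fun y hy => ⟨hy.1, fun _ => hy.2 S⟩
    · rw [hsub (hpt D), ha.carrier_eq_signCell hl]
      exact fun y hy => ⟨hy.1, fun _ => hy.2 S⟩

theorem IsDefining.dist_eq (ha : IsDefining a) (hl : 1 ≤ l) (C D : A.Chamber) :
    dist C D = (sep a C D).ncard := by
  rw [dist, ← Set.ncard_image_of_injective (sep a C D) Subtype.val_injective]
  congr 1
  ext S
  constructor
  · rintro ⟨hS, h⟩
    exact ⟨⟨S, hS⟩, (ha.separates_iff hl C D ⟨S, hS⟩).1 h, rfl⟩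
  · rintro ⟨T, hT, rfl⟩
    exact ⟨T.2, (ha.separates_iff hl C D T).2 hT⟩

end sep

end SphereArrangement

/-! ### Edges, path lengths and boundaries of `2`-cells. -/

namespace SphereArrangement

open Filter Topology Module SphArr

variable {l : ℕ} {A : SphereArrangement l} {a : A.spheres → SphAmbient l →L[ℝ] ℝ}

theorem IsDefining.exists_edge_data (ha : IsDefining a) (hl : 2 ≤ l) {C D : A.Chamber}
    (e : SalEdge C D) : ∃ x ∈ unitSphere l, ∃ S, e.face = signCell a x ∧ sep a C D = {S} ∧
      (∀ T, a T x = 0 ↔ T = S) ∧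
      (∀ T, T ≠ S → SignType.sign (a T x) = SignType.sign (a T C.point)) ∧
      (∀ T, T ≠ S → SignType.sign (a T x) = SignType.sign (a T D.point)) := by
  obtain ⟨x, hx, hF, hflat⟩ := ha.exists_eq_signCell (by omega) e.isFace
  obtain ⟨S, hS⟩ := ha.existsUnique_of_finrank_flat (x := x) (by omega)
  have hxF : x ∈ e.face := hF ▸ mem_signCell_self hx
  have hC : ∀ T, T ≠ S → SignType.sign (a T x) = SignType.sign (a T C.point) := by
    intro T hT
    have := e.subset_source hxF
    rw [ha.carrier_eq_signCell (by omega)] at this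
    exact sign_eq_of_mem_closure_signCell this fun h => hT ((hS T).1 h)
  have hD : ∀ T, T ≠ S → SignType.sign (a T x) = SignType.sign (a T D.point) := by
    intro T hT
    have := e.subset_target hxF
    rw [ha.carrier_eq_signCell (by omega)] at this
    exact sign_eq_of_mem_closure_signCell this fun h => hT ((hS T).1 h)
  refine ⟨x, hx, S, hF, ?_, hS, hC, hD⟩
  have hsub : sep a C D ⊆ {S} := by
    intro T hT
    by_contra h
    exact hT ((hC T h).symm.trans (hD T h))
  rcases Set.subset_singleton_iff_eq.1 hsub with h | h
  · exact absurd (ha.chamber_ext (by omega) h) e.ne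
  · exact h

theorem IsDefining.edge_eq (ha : IsDefining a) (hl : 2 ≤ l) {C D : A.Chamber}
    (e e' : SalEdge C D) : e = e' := by
  have h : e.face = e'.face := by
    obtain ⟨x, -, S, hF, hsep, hS, hC, -⟩ := ha.exists_edge_data hl e
    obtain ⟨x', -, S', hF', hsep', hS', hC', -⟩ := ha.exists_edge_data hl e'
    obtain rfl : S = S' := Set.singleton_injective (hsep.symm.trans hsep')
    rw [hF, hF']
    refine signCell_congr fun T => ?_
    by_cases hT : T = S
    · rw [(hS T).2 hT, (hS' T).2 hT]
    · rw [hC T hT, hC' T hT]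
  cases e; cases e'; cases h; rfl

theorem IsDefining.exists_edge (ha : IsDefining a) (hl : 1 ≤ l) {C D : A.Chamber} {S : A.spheres}
    (hsep : sep a C D = {S}) {z : SphAmbient l} (hz : z ≠ 0) (hS : ∀ T, a T z = 0 ↔ T = S)
    (hD : ∀ T, T ≠ S → SignType.sign (a T z) = SignType.sign (a T D.point)) :
    Nonempty (SalEdge C D) := by
  have hu : ‖z‖⁻¹ • z ∈ unitSphere l := norm_inv_smul_mem_sphere hz
  have hzero : ∀ T, a T (‖z‖⁻¹ • z) = 0 ↔ a T z = 0 := fun T => by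
    rw [← sign_eq_zero_iff, sign_normalize _ hz, sign_eq_zero_iff]
  have hsub : ∀ E : A.Chamber, (∀ T, T ≠ S → SignType.sign (a T E.point) =
      SignType.sign (a T D.point)) →
      connectedComponentIn (stratum A.spheres (‖z‖⁻¹ • z)) (‖z‖⁻¹ • z) ⊆ closure E.carrier := by
    intro E hE
    refine (ha.face_subset_signCell hu).trans ?_
    rw [ha.carrier_eq_signCell hl]
    refine signCell_subset_closure fun T hT => ?_
    have hTS : T ≠ S := fun h => hT ((hzero T).2 ((hS T).2 h))
    rw [sign_normalize _ hz, hD T hTS, hE T hTS]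
  refine ⟨⟨_, (ha.isFaceOfCodim_iff hu 1).2 ⟨hl, ?_⟩, hsub C ?_, hsub D fun _ _ => rfl, ?_⟩⟩
  · rw [ha.finrank_flat_of_forall_iff fun T => (hzero T).trans (hS T)]
  · intro T hT
    rw [← notMem_sep, hsep]
    exact hT
  · rintro rfl
    rw [sep_self] at hsep
    exact Set.singleton_ne_empty _ hsep.symm

/-- Each edge, in either direction, changes exactly one sign. -/
theorem IsDefining.ncard_sep_le_length (ha : IsDefining a) (hl : 2 ≤ l) {C D : A.Chamber}
    (p : EdgePath C D) : (sep a C D).ncard ≤ p.length := by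
  induction p with
  | nil => rw [sep_self, Set.ncard_empty]; exact Nat.zero_le _
  | @cons X D p e ih =>
    have h1 : (sep a X D).ncard = 1 := by
      rcases e with e | e
      · obtain ⟨_, _, S, _, hsep, _⟩ := ha.exists_edge_data hl e
        rw [hsep, Set.ncard_singleton]
      · obtain ⟨_, _, S, _, hsep, _⟩ := ha.exists_edge_data hl e
        rw [sep_comm, hsep, Set.ncard_singleton]
    have h2 := (Set.ncard_le_ncard (sep_subset_union (a := a) C X D)).trans
      (Set.ncard_union_le _ _)
    exact h2.trans ((congrArg _ h1).trans_le (Nat.add_le_add_right ih 1))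

/-- A positive path as an edge path. -/
def toEdgePath {C D : A.Chamber} (p : PosPath C D) : EdgePath C D :=
  Quiver.Symmetrify.of.mapPath p

theorem length_toEdgePath {C D : A.Chamber} (p : PosPath C D) :
    (toEdgePath p).length = p.length := by
  induction p with
  | nil => rfl
  | cons p e ih => exact congrArg (· + 1) ih

theorem IsDefining.ncard_sep_le_length_pos (ha : IsDefining a) (hl : 2 ≤ l) {C D : A.Chamber}
    (p : PosPath C D) : (sep a C D).ncard ≤ p.length :=
  (ha.ncard_sep_le_length hl (toEdgePath p)).trans_eq (length_toEdgePath p)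

theorem IsDefining.isMinimal_of_length (ha : IsDefining a) (hl : 2 ≤ l) {C D : A.Chamber}
    {p : PosPath C D} (hp : p.length = (sep a C D).ncard) : IsMinimal p :=
  fun q => hp.trans_le (ha.ncard_sep_le_length hl q)

/-- A geodesic ending with the edge `e` crosses the hypersphere of `e` only once. -/
theorem IsDefining.length_of_length_cons (ha : IsDefining a) (hl : 2 ≤ l) {C X D : A.Chamber}
    {p : PosPath C X} {e : X ⟶ D} (h : (p.cons e).length = (sep a C D).ncard) :
    p.length = (sep a C X).ncard ∧ sep a X D ⊆ sep a C D ∧ sep a C X = sep a C D \ sep a X D := by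
  obtain ⟨-, -, S, -, hsep, -⟩ := ha.exists_edge_data hl e
  have h1 := ha.ncard_sep_le_length_pos hl p
  rw [Quiver.Path.length_cons] at h
  have h2 := ha.sep_eq_symmDiff C X D
  -- Otherwise the last edge would cross `S` back, and `p` would be shorter than the number of
  -- hyperspheres separating its ends.
  have h3 : S ∉ sep a C X := by
    intro hS
    have h4 : sep a C D ⊆ sep a C X := by
      rw [h2, hsep, Set.symmDiff_def]
      rintro T (hT | ⟨rfl, hT⟩)
      · exact hT.1
      · exact absurd hS hT
    have := Set.ncard_le_ncard h4
    omega
  rw [hsep] at h2 ⊢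
  have h5 : sep a C D = insert S (sep a C X) := by
    rw [h2]
    ext T
    simp only [Set.mem_symmDiff, Set.mem_singleton_iff, Set.mem_insert_iff]
    constructor
    · tauto
    · rintro (rfl | hT)
      · exact Or.inr ⟨rfl, h3⟩
      · exact Or.inl ⟨hT, fun h => h3 (h ▸ hT)⟩
  refine ⟨?_, ?_, ?_⟩
  · rw [h5, Set.ncard_insert_of_notMem h3] at h
    omega
  · rw [h5]; exact Set.singleton_subset_iff.2 (Set.mem_insert _ _)
  · rw [h5]
    ext T
    simp only [Set.mem_sdiff, Set.mem_singleton_iff, Set.mem_insert_iff]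
    constructor
    · exact fun hT => ⟨Or.inr hT, fun h => h3 (h ▸ hT)⟩
    · tauto

/-- The positive paths around a face of codimension two without repeated crossings run in the
boundary of the corresponding `2`-cell. -/
theorem IsDefining.inBoundaryOf (ha : IsDefining a) (hl : 2 ≤ l) {C D : A.Chamber}
    {z : SphAmbient l} (hz : z ∈ unitSphere l) (hflat : finrank ℝ (flat a z) + 2 = l + 1)
    (c : A.SalCell 2) (hcC : c.chamber = C)
    (hcF : c.face = connectedComponentIn (stratum A.spheres z) z)
    (hC : ∀ S, a S z ≠ 0 → SignType.sign (a S z) = SignType.sign (a S C.point))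
    (p : PosPath C D) (hp : p.length = (sep a C D).ncard)
    (hsep : ∀ S ∈ sep a C D, a S z = 0) : InBoundaryOf c p := by
  induction p with
  | nil => trivial
  | @cons X D p e ih =>
    obtain ⟨h1, h2, h3⟩ := ha.length_of_length_cons hl hp
    refine ⟨ih h1 fun S hS => hsep S (h3 ▸ hS : S ∈ sep a C D \ sep a X D).1, ?_⟩
    obtain ⟨x, hx, S, hF, hXD, hS, hxX, hxD⟩ := ha.exists_edge_data hl e
    rw [hXD] at h2 h3
    have hSz : a S z = 0 := hsep S (h2 rfl)
    refine ⟨?_, ?_, e.subset_source, ?_⟩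
    · intro h
      have hzx : z ∈ signCell a x := by
        rw [← hF]
        change z ∈ (SalEdge.cell e).face
        rw [h, hcF]
        exact mem_connectedComponentIn (mem_stratum_self hz)
      have h5 : flat a z = flat a x := flat_congr fun T => by
        rw [← sign_eq_zero_iff, hzx.2, sign_eq_zero_iff]
      rw [h5, ha.finrank_flat_of_forall_iff hS] at hflat
      omega
    · rw [hcF]
      change _ ⊆ closure e.face
      rw [hF]
      refine (ha.face_subset_signCell hz).trans (signCell_subset_closure fun T hT => ?_)
      have hTS : T ≠ S := fun h => hT (h ▸ hSz)
      rw [hC T hT, hxX T hTS, ← notMem_sep, h3]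
      exact fun hT' => hT (hsep T hT'.1)
    -- Around the face of `e` all signs except that of `S` are forced, and `S` does not separate `C`
    -- from `X`. So whatever separates `C` from `X` also separates `C` from `C'`, and `X` attains
    -- the minimal distance.
    · intro C' hC'
      rw [hcC, ha.dist_eq (by omega), ha.dist_eq (by omega)]
      refine Set.ncard_le_ncard ?_
      change sep a C X ⊆ _
      intro T hT
      have hTS : T ≠ S := (h3 ▸ hT : T ∈ sep a C D \ {S}).2
      have hx' : x ∈ closure C'.carrier := hC' (hF ▸ mem_signCell_self hx : x ∈ e.face)
      rw [ha.carrier_eq_signCell (by omega)] at hx'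
      have := sign_eq_of_mem_closure_signCell hx' (i := T) fun h => hTS ((hS T).1 h)
      change _ ≠ _
      rw [← this, hxX T hTS]
      exact hT

/-- Geodesics from `E` to `D` are positively equivalent if the separating hyperspheres are those
through a face of codimension two in the closures of both chambers. -/
theorem IsDefining.posClass_eq_of_codim_two (ha : IsDefining a) (hl : 2 ≤ l) {C D : A.Chamber}
    {z : SphAmbient l} (hz : z ≠ 0) (hflat : finrank ℝ (flat a z) + 2 = l + 1)
    (hC : ∀ S, a S z ≠ 0 → SignType.sign (a S z) = SignType.sign (a S C.point))
    (hsep : ∀ S ∈ sep a C D, a S z = 0)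
    (p q : PosPath C D) (hp : p.length = (sep a C D).ncard) (hq : q.length = (sep a C D).ncard) :
    posClass p = posClass q := by
  have hu : ‖z‖⁻¹ • z ∈ unitSphere l := norm_inv_smul_mem_sphere hz
  have hsgn : ∀ S, SignType.sign (a S (‖z‖⁻¹ • z)) = SignType.sign (a S z) :=
    fun S => sign_normalize _ hz
  have hzero : ∀ S, a S (‖z‖⁻¹ • z) = 0 ↔ a S z = 0 := fun S => by
    rw [← sign_eq_zero_iff, hsgn, sign_eq_zero_iff]
  rw [← flat_congr hzero] at hflat
  have hC' : ∀ S, a S (‖z‖⁻¹ • z) ≠ 0 →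
      SignType.sign (a S (‖z‖⁻¹ • z)) = SignType.sign (a S C.point) :=
    fun S hS => (hsgn S).trans (hC S fun h => hS ((hzero S).2 h))
  let c : A.SalCell 2 := ⟨_, C, (ha.isFaceOfCodim_iff hu 2).2 ⟨hl, hflat⟩, by
    refine (ha.face_subset_signCell hu).trans ?_
    rw [ha.carrier_eq_signCell (by omega)]
    exact signCell_subset_closure hC'⟩
  exact CategoryTheory.Quotient.sound _ ⟨c, ha.isMinimal_of_length hl hp,
    ha.isMinimal_of_length hl hq,
    ha.inBoundaryOf hl hu hflat c rfl rfl hC' p hp fun S hS => (hzero S).2 (hsep S hS),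
    ha.inBoundaryOf hl hu hflat c rfl rfl hC' q hq fun S hS => (hzero S).2 (hsep S hS)⟩

theorem IsDefining.eq_of_length_eq_one (ha : IsDefining a) (hl : 2 ≤ l) {C D : A.Chamber}
    (p q : PosPath C D) (hp : p.length = 1) (hq : q.length = 1) : p = q := by
  rcases p with _ | ⟨p, e⟩
  · simp at hp
  rcases q with _ | ⟨q, f⟩
  · simp at hq
  obtain rfl := Quiver.Path.eq_of_length_zero p (by simpa using hp)
  obtain rfl := Quiver.Path.eq_of_length_zero q (by simpa using hq)
  rw [Quiver.Path.eq_nil_of_length_zero p (by simpa using hp),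
    Quiver.Path.eq_nil_of_length_zero q (by simpa using hq), ha.edge_eq hl e f]

end SphereArrangement

/-! ### Generic rays leaving a chamber, and existence of geodesics. -/

namespace SphereArrangement

open Filter Topology Module SphArr

section ratio

theorem sign_add_mul_of_lt {q y d r : ℝ} (hd : d ≠ 0) (hy0 : y ≠ 0)
    (hy : SignType.sign y ≠ SignType.sign d) (hr : r < -q / y) :
    SignType.sign (q + r * y) = SignType.sign d := by
  rcases lt_or_gt_of_ne hd with h | h <;> rcases lt_or_gt_of_ne hy0 with h' | h'
  · rw [sign_neg h, sign_neg h'] at hy; exact absurd rfl hy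
  · rw [lt_div_iff₀ h'] at hr
    rw [sign_neg h, sign_neg (by linarith)]
  · rw [lt_div_iff_of_neg h'] at hr
    rw [sign_pos h, sign_pos (by linarith)]
  · rw [sign_pos h, sign_pos h'] at hy; exact absurd rfl hy

theorem sign_add_mul_of_nonneg {q y d r : ℝ} (hd : d ≠ 0)
    (hq : SignType.sign q = SignType.sign d)
    (hy : SignType.sign y = SignType.sign d) (hr : 0 ≤ r) :
    SignType.sign (q + r * y) = SignType.sign d := by
  rcases lt_or_gt_of_ne hd with h | h
  · rw [sign_neg h, sign_eq_neg_one_iff] at *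
    nlinarith [mul_nonneg hr (neg_nonneg.2 hy.le)]
  · rw [sign_pos h, sign_eq_one_iff] at *
    nlinarith [mul_nonneg hr hy.le]

theorem neg_div_pos_of_sign {q y d : ℝ} (hd : d ≠ 0) (hy0 : y ≠ 0)
    (hq : SignType.sign q = SignType.sign d) (hy : SignType.sign y ≠ SignType.sign d) :
    0 < -q / y := by
  rcases lt_or_gt_of_ne hd with h | h <;> rcases lt_or_gt_of_ne hy0 with h' | h'
  · rw [sign_neg h, sign_neg h'] at hy; exact absurd rfl hy
  · rw [sign_neg h, sign_eq_neg_one_iff] at hq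
    exact div_pos (neg_pos.2 hq) h'
  · rw [sign_pos h, sign_eq_one_iff] at hq
    exact div_pos_of_neg_of_neg (neg_neg_of_pos hq) h'
  · rw [sign_pos h, sign_pos h'] at hy; exact absurd rfl hy

end ratio

variable {l : ℕ} {A : SphereArrangement l} {a : A.spheres → SphAmbient l →L[ℝ] ℝ}

/-- The members of `T` that the ray from `q` in the direction `y` meets first. -/
def exits (a : A.spheres → SphAmbient l →L[ℝ] ℝ) (T : Set A.spheres) (y q : SphAmbient l) :
    Set A.spheres :=
  {S | S ∈ T ∧ ∀ S' ∈ T, -(a S q) / a S y ≤ -(a S' q) / a S' y}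

/-- The hitting parameter of each member is continuous in `q`, so a member strictly beaten at `q₀`
stays beaten nearby. Ties may break, which is why only an inclusion holds. -/
theorem eventually_exits_subset (T : Set A.spheres) (y q₀ : SphAmbient l) :
    ∀ᶠ q in 𝓝 q₀, exits a T y q ⊆ exits a T y q₀ := by
  have key : ∀ S : A.spheres, ∀ᶠ q in 𝓝 q₀, S ∈ exits a T y q → S ∈ exits a T y q₀ := by
    intro S
    by_cases hS : S ∈ exits a T y q₀
    · exact Eventually.of_forall fun _ _ => hS
    by_cases hT : S ∈ T
    · have : ∃ S' ∈ T, -(a S' q₀) / a S' y < -(a S q₀) / a S y := by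
        by_contra! h
        exact hS ⟨hT, h⟩
      obtain ⟨S', hS', hlt⟩ := this
      have h1 : ContinuousAt (fun q => -(a S' q) / a S' y) q₀ := by fun_prop
      have h2 : ContinuousAt (fun q => -(a S q) / a S y) q₀ := by fun_prop
      filter_upwards [h1.eventually_lt h2 hlt] with q hq hqS
      exact absurd (hqS.2 S' hS') (not_le.2 hq)
    · exact Eventually.of_forall fun _ h => absurd h.1 hT
  filter_upwards [eventually_all.2 key] with q hq S hS using hq S hS

/-- The ray from a point `q` in the closure of a chamber `D` towards a point `y` of a chamber `C`
leaves the closure of `D` in a point of the members met first. -/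
theorem IsDefining.exists_exit_point (ha : IsDefining a) {C D : A.Chamber} {y q : SphAmbient l}
    (hne : (sep a C D).Nonempty)
    (hy : ∀ S, SignType.sign (a S y) = SignType.sign (a S C.point))
    (hq0 : ∀ S, S ∉ sep a C D → SignType.sign (a S q) = SignType.sign (a S D.point))
    (hq1 : ∀ S, a S q = 0 ∨ SignType.sign (a S q) = SignType.sign (a S D.point)) :
    (exits a (sep a C D) y q).Nonempty ∧ ∃ r : ℝ, 0 ≤ r ∧
      (∀ S, a S (q + r • y) = 0 ↔ S ∈ exits a (sep a C D) y q) ∧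
      (∀ S, S ∉ exits a (sep a C D) y q →
        SignType.sign (a S (q + r • y)) = SignType.sign (a S D.point)) := by
  have hy0 : ∀ S, a S y ≠ 0 := fun S => by
    rw [← sign_ne_zero, hy, sign_ne_zero]; exact ha.point_ne_zero C S
  obtain ⟨S₀, hS₀, hmin⟩ := (Set.toFinite (sep a C D)).exists_minimalFor
    (fun S => -(a S q) / a S y) _ hne
  have hS₀' : S₀ ∈ exits a (sep a C D) y q := by
    refine ⟨hS₀, fun S hS => ?_⟩
    by_contra! h
    exact absurd (hmin hS h.le) (not_le.2 h)
  have hsgn : ∀ S ∈ sep a C D, SignType.sign (a S y) ≠ SignType.sign (a S D.point) := by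
    intro S hS
    rw [hy]; exact hS
  have hr : 0 ≤ -(a S₀ q) / a S₀ y := by
    rcases hq1 S₀ with h | h
    · simp [h]
    · exact (neg_div_pos_of_sign (ha.point_ne_zero D S₀) (hy0 S₀) h (hsgn S₀ hS₀)).le
  have hin : ∀ S ∈ exits a (sep a C D) y q, a S (q + (-(a S₀ q) / a S₀ y) • y) = 0 := by
    intro S hS
    rw [le_antisymm (hS₀'.2 S hS.1) (hS.2 S₀ hS₀), map_add, map_smul, smul_eq_mul,
      div_mul_cancel₀ _ (hy0 S), add_neg_cancel]
  have hout : ∀ S, S ∉ exits a (sep a C D) y q →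
      SignType.sign (a S (q + (-(a S₀ q) / a S₀ y) • y)) = SignType.sign (a S D.point) := by
    intro S hS
    rw [map_add, map_smul, smul_eq_mul]
    -- A separating member is met only at a strictly later parameter; any other member has `q` and
    -- `y` on the same side as `D` and is never met.
    by_cases hT : S ∈ sep a C D
    · refine sign_add_mul_of_lt (ha.point_ne_zero D S) (hy0 S) (hsgn S hT) ?_
      by_contra! h
      exact hS ⟨hT, fun S' hS' => h.trans (hS₀'.2 S' hS')⟩
    · refine sign_add_mul_of_nonneg (ha.point_ne_zero D S) (hq0 S hT) ?_ hr
      rw [hy]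
      exact notMem_sep.1 hT
  refine ⟨⟨S₀, hS₀'⟩, _, hr, fun S => ⟨fun h => ?_, hin S⟩, hout⟩
  by_contra hS
  have := hout S hS
  rw [h, sign_zero, eq_comm, sign_eq_zero_iff] at this
  exact ha.point_ne_zero D S this

/-- The sign conditions of `C` are open, and the complement of finitely many proper subspaces is
dense. -/
theorem IsDefining.exists_generic (ha : IsDefining a) (C : A.Chamber)
    {𝒲 : Set (Submodule ℝ (SphAmbient l))} (hfin : 𝒲.Finite) (htop : ∀ W ∈ 𝒲, W ≠ ⊤) :
    ∃ y, (∀ S, SignType.sign (a S y) = SignType.sign (a S C.point)) ∧ ∀ W ∈ 𝒲, y ∉ W := by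
  have hdense : Dense (⋂ W ∈ 𝒲, ((W : Set (SphAmbient l))ᶜ)) := by
    refine dense_biInter_of_isOpen (fun W _ => W.closed_of_finiteDimensional.isOpen_compl)
      hfin.countable fun W hW => ?_
    rw [← interior_eq_empty_iff_dense_compl]
    by_contra h
    exact htop W hW (W.eq_top_of_nonempty_interior' (Set.nonempty_iff_ne_empty.2 h))
  have hev : ∀ᶠ y in 𝓝 C.point, ∀ S, SignType.sign (a S y) = SignType.sign (a S C.point) := by
    rw [eventually_all]
    intro S
    rcases lt_or_gt_of_ne (ha.point_ne_zero C S) with h | h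
    · filter_upwards [(a S).continuous.continuousAt.eventually (gt_mem_nhds h)] with y hy
      rw [sign_neg h, sign_neg hy]
    · filter_upwards [(a S).continuous.continuousAt.eventually (lt_mem_nhds h)] with y hy
      rw [sign_pos h, sign_pos hy]
  obtain ⟨U, hU, hUo, hCU⟩ := eventually_nhds_iff.1 hev
  obtain ⟨y, hyU, hy⟩ := hdense.inter_open_nonempty U hUo ⟨_, hCU⟩
  refine ⟨y, hU y hyU, fun W hW => ?_⟩
  rw [Set.mem_iInter₂] at hy
  exact hy W hW

theorem finite_range_flat : (Set.range (flat a)).Finite := by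
  have : Set.range (flat a) ⊆ Set.range fun M : Set A.spheres =>
      ⨅ (i : A.spheres) (_ : i ∈ M), LinearMap.ker (a i : SphAmbient l →ₗ[ℝ] ℝ) := by
    rintro _ ⟨x, rfl⟩
    exact ⟨{i | a i x = 0}, rfl⟩
  exact (Set.finite_range _).subset this

/-- In every chamber there is a point `y` such that the span of `P` and `y` meets the flats outside
`P` as little as their dimensions allow. -/
theorem IsDefining.exists_generic_direction (ha : IsDefining a) (C : A.Chamber)
    (P : Submodule ℝ (SphAmbient l)) (hP : finrank ℝ P < l + 1) :
    ∃ y, (∀ S, SignType.sign (a S y) = SignType.sign (a S C.point)) ∧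
      ∀ q ∈ P, ∀ r : ℝ, r ≠ 0 → q + r • y ≠ 0 ∧
        l + 1 ≤ finrank ℝ (flat a (q + r • y)) + finrank ℝ P := by
  -- If `q + r • y` lies in `L` with `r ≠ 0`, then `y` lies in `P ⊔ L`; the rank condition makes
  -- this subspace proper, so it can be avoided. The extra choice `L = ⊥` excludes `q + r • y = 0`.
  let 𝒲 : Set (Submodule ℝ (SphAmbient l)) :=
    {W | ∃ L ∈ insert ⊥ (Set.range (flat a)), W = P ⊔ L ∧ finrank ℝ L + finrank ℝ P < l + 1}
  have hfin : 𝒲.Finite := by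
    refine (((finite_range_flat (a := a)).insert ⊥).image (fun L => P ⊔ L)).subset ?_
    rintro _ ⟨L, hL, rfl, -⟩
    exact ⟨L, hL, rfl⟩
  obtain ⟨y, hy, hyW⟩ := ha.exists_generic C hfin (by
    rintro _ ⟨L, -, rfl, hlt⟩ htop
    have := Submodule.finrank_add_le_finrank_add_finrank P L
    rw [htop, finrank_top, finrank_euclideanSpace_fin] at this
    omega)
  have key : ∀ q ∈ P, ∀ r : ℝ, r ≠ 0 → ∀ L : Submodule ℝ (SphAmbient l), q + r • y ∈ L →
      y ∈ P ⊔ L := by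
    intro q hq r hr L hL
    have h1 : (q + r • y) - q ∈ P ⊔ L :=
      Submodule.sub_mem _ (Submodule.mem_sup_right hL) (Submodule.mem_sup_left hq)
    rw [add_sub_cancel_left] at h1
    exact (Submodule.smul_mem_iff _ hr).1 h1
  refine ⟨y, hy, fun q hq r hr => ⟨fun h0 => ?_, ?_⟩⟩
  · refine hyW _ ⟨⊥, Set.mem_insert _ _, rfl, by simpa using hP⟩ (key q hq r hr ⊥ ?_)
    rw [h0]; exact Submodule.zero_mem _
  · by_contra! hlt
    exact hyW _ ⟨_, Set.mem_insert_of_mem _ ⟨q + r • y, rfl⟩, rfl, hlt⟩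
      (key q hq r hr _ (mem_flat.2 fun _ h => h))

theorem IsDefining.exists_chamber_flip (ha : IsDefining a) (hl : 1 ≤ l) {C D : A.Chamber}
    {z y : SphAmbient l} {M : Set A.spheres} (hM : M.Nonempty) (hMsep : M ⊆ sep a C D)
    (hy : ∀ S, SignType.sign (a S y) = SignType.sign (a S C.point))
    (hz : ∀ S, a S z = 0 ↔ S ∈ M)
    (hzD : ∀ S, S ∉ M → SignType.sign (a S z) = SignType.sign (a S D.point)) :
    ∃ E : A.Chamber, sep a E D = M := by
  -- Going slightly beyond the exit point towards `y` gives the members of `M` the signs of `C` and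
  -- leaves all others with the signs of `D`.
  obtain ⟨ε, hε⟩ := (eventually_sign_add_smul a z y).exists
  have hw : ∀ S, a S (z + ε • y) ≠ 0 := by
    intro S
    rw [← sign_ne_zero]
    by_cases hS : a S z = 0
    · rw [(hε S).1 hS, hy, sign_ne_zero]; exact ha.point_ne_zero C S
    · rwa [(hε S).2 hS, sign_ne_zero]
  have hw0 : z + ε • y ≠ 0 := by
    obtain ⟨S, -⟩ := hM
    intro h
    exact hw S (by rw [h, map_zero])
  obtain ⟨E, hE⟩ := ha.exists_chamber hl hw0 hw
  refine ⟨E, ?_⟩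
  ext S
  by_cases hS : S ∈ M
  · refine iff_of_true ?_ hS
    change _ ≠ _
    rw [hE, (hε S).1 ((hz S).2 hS), hy]
    exact hMsep hS
  · refine iff_of_false ?_ hS
    rw [notMem_sep, hE, (hε S).2 fun h => hS ((hz S).1 h), hzD S hS]

/-- Built backwards from `D`: a generic ray from a point of `D` leaves through a single hypersphere,
and the chamber behind it is one step closer to `C`. This identifies the length of minimal paths
with the number of separating hyperspheres. -/
theorem IsDefining.exists_geodesic (ha : IsDefining a) (hl : 2 ≤ l) (C D : A.Chamber) :
    ∃ p : PosPath C D, p.length = (sep a C D).ncard := by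
  induction hn : (sep a C D).ncard generalizing D with
  | zero =>
    rw [Set.ncard_eq_zero] at hn
    obtain rfl := ha.chamber_ext (by omega) hn
    exact ⟨Quiver.Path.nil, rfl⟩
  | succ n ih =>
    have hne : (sep a C D).Nonempty := (Set.ncard_pos).1 (by omega)
    have hD0 : D.point ≠ 0 := ne_zero_of_mem_unit_sphere ⟨_, D.point_mem⟩
    obtain ⟨y, hy, hgen⟩ := ha.exists_generic_direction C (Submodule.span ℝ {D.point})
      (by rw [finrank_span_singleton hD0]; omega)
    obtain ⟨hM, r, hr, hz, hzD⟩ := ha.exists_exit_point (q := D.point) hne hy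
      (fun _ _ => rfl) (fun _ => Or.inr rfl)
    have hr0 : r ≠ 0 := by
      rintro rfl
      obtain ⟨S, hS⟩ := hM
      have := (hz S).2 hS
      rw [zero_smul, add_zero] at this
      exact ha.point_ne_zero D S this
    -- With `P` a line, the flat of the exit point has rank at least `l`; since some member vanishes
    -- there, the rank is exactly `l`.
    obtain ⟨hz0, hrank⟩ := hgen D.point (Submodule.mem_span_singleton_self _) r hr0
    rw [finrank_span_singleton hD0] at hrank
    have hle := (flat a (D.point + r • y)).finrank_le
    rw [finrank_euclideanSpace_fin] at hle
    have hne1 : finrank ℝ (flat a (D.point + r • y)) ≠ l + 1 := by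
      intro h
      obtain ⟨S, hS⟩ := hM
      exact ha.ne_zero_of_finrank_flat h S ((hz S).2 hS)
    obtain ⟨S, hS⟩ := ha.existsUnique_of_finrank_flat
      (x := D.point + r • y) (by omega)
    have hMS : exits a (sep a C D) y D.point = {S} := by
      ext T
      rw [← hz, hS, Set.mem_singleton_iff]
    obtain ⟨E, hE⟩ := ha.exists_chamber_flip (by omega) hM (fun _ h => h.1) hy hz hzD
    have hadd := ha.ncard_sep_of_subset (C := C) (D := D) (E := E) (hE ▸ fun _ h => h.1)
    rw [hMS] at hE
    obtain ⟨e⟩ := ha.exists_edge (by omega) hE hz0 hS fun T hT =>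
      hzD T (by rw [hMS]; exact hT)
    rw [hE, Set.ncard_singleton] at hadd
    obtain ⟨p, hp⟩ := ih E (by omega)
    exact ⟨p.cons e, by rw [Quiver.Path.length_cons, hp]⟩

theorem IsDefining.length_eq_of_isMinimal (ha : IsDefining a) (hl : 2 ≤ l) {C D : A.Chamber}
    {p : PosPath C D} (hp : IsMinimal p) : p.length = (sep a C D).ncard := by
  obtain ⟨q, hq⟩ := ha.exists_geodesic hl C D
  refine le_antisymm ?_ (ha.ncard_sep_le_length_pos hl p)
  rw [← hq, ← length_toEdgePath q]
  exact hp _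

end SphereArrangement

/-! ### Positive equivalence of geodesics. -/

namespace SphereArrangement

open Filter Topology Module SphArr

variable {l : ℕ} {A : SphereArrangement l} {a : A.spheres → SphAmbient l →L[ℝ] ℝ}

theorem posClass_comp {C D E : A.Chamber} (p : PosPath C D) (q : PosPath D E) :
    posClass (Quiver.Path.comp p q) = posClass p ≫ posClass q :=
  (CategoryTheory.Quotient.functor A.elemRel).map_comp
    (X := (Paths.of A.Chamber).obj C) (Y := (Paths.of A.Chamber).obj D)
    (Z := (Paths.of A.Chamber).obj E) p q

/-- The geodesics from `E` to `D` are positively equivalent if the separating hyperspheres are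
those through a face of codimension one or two in the closure of `D`. -/
theorem IsDefining.posClass_eq_of_flat (ha : IsDefining a) (hl : 2 ≤ l) {E D : A.Chamber}
    {z : SphAmbient l} (hz0 : z ≠ 0) (hne : (sep a E D).Nonempty)
    (hz : ∀ S, a S z = 0 ↔ S ∈ sep a E D)
    (hzD : ∀ S, S ∉ sep a E D → SignType.sign (a S z) = SignType.sign (a S D.point))
    (hrank : l ≤ finrank ℝ (flat a z) + 1)
    (p q : PosPath E D) (hp : p.length = (sep a E D).ncard) (hq : q.length = (sep a E D).ncard) :
    posClass p = posClass q := by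
  have hle := (flat a z).finrank_le
  rw [finrank_euclideanSpace_fin] at hle
  have hne1 : finrank ℝ (flat a z) ≠ l + 1 := by
    intro h
    obtain ⟨S, hS⟩ := hne
    exact ha.ne_zero_of_finrank_flat h S ((hz S).2 hS)
  by_cases h1 : finrank ℝ (flat a z) = l
  · obtain ⟨S, hS⟩ := ha.existsUnique_of_finrank_flat h1
    have hsep : sep a E D = {S} := by
      ext T
      rw [← hz, hS, Set.mem_singleton_iff]
    rw [hsep, Set.ncard_singleton] at hp hq
    rw [ha.eq_of_length_eq_one hl p q hp hq]
  · refine ha.posClass_eq_of_codim_two hl hz0 (by omega) (fun S hS => ?_)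
      (fun S hS => (hz S).2 hS) p q hp hq
    have hS' : S ∉ sep a E D := fun h => hS ((hz S).2 h)
    rw [hzD S hS', ← notMem_sep.1 hS']

theorem IsDefining.exits_eq_singleton (ha : IsDefining a) {C D : A.Chamber} {S : A.spheres}
    {x y : SphAmbient l} (hS : S ∈ sep a C D)
    (hy : ∀ S, SignType.sign (a S y) = SignType.sign (a S C.point))
    (hx : ∀ T, a T x = 0 ↔ T = S)
    (hxD : ∀ T, T ≠ S → SignType.sign (a T x) = SignType.sign (a T D.point)) :
    exits a (sep a C D) y x = {S} := by
  have hS0 : -(a S x) / a S y = 0 := by rw [(hx S).2 rfl, neg_zero, zero_div]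
  have hpos : ∀ T ∈ sep a C D, T ≠ S → 0 < -(a T x) / a T y := by
    intro T hT hTS
    refine neg_div_pos_of_sign (ha.point_ne_zero D T) ?_ (hxD T hTS) ?_
    · rw [← sign_ne_zero, hy, sign_ne_zero]; exact ha.point_ne_zero C T
    · rw [hy]; exact hT
  ext T
  constructor
  · intro hT
    by_contra hTS
    exact absurd (hT.2 S hS) (not_le.2 (hS0 ▸ hpos T hT.1 hTS))
  · intro hT
    rw [Set.mem_singleton_iff.1 hT]
    refine ⟨hS, fun T hT => ?_⟩
    by_cases h : T = S
    · rw [h]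
    · rw [hS0]; exact (hpos T hT h).le

theorem IsDefining.posClass_eq_of_geodesic (ha : IsDefining a) (hl : 2 ≤ l) :
    ∀ (n : ℕ) (C D : A.Chamber), (sep a C D).ncard = n → ∀ p q : PosPath C D,
      p.length = n → q.length = n → posClass p = posClass q := by
  intro n
  induction n using Nat.strong_induction_on with
  | _ n ih =>
  intro C D hn p q hp hq
  rcases p with _ | ⟨p, e⟩
  · rw [Quiver.Path.length_nil] at hp
    rw [Quiver.Path.eq_nil_of_length_zero q (by omega)]
  rcases q with _ | ⟨q, f⟩
  · rw [Quiver.Path.length_nil] at hq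
    rw [Quiver.Path.length_cons] at hp
    omega
  rename_i D₁ D₂
  obtain ⟨hp1, hp2, -⟩ := ha.length_of_length_cons hl (hp.trans hn.symm)
  obtain ⟨hq1, hq2, -⟩ := ha.length_of_length_cons hl (hq.trans hn.symm)
  obtain ⟨x₁, hx₁, S₁, -, hsep₁, hS₁, -, hxD₁⟩ := ha.exists_edge_data hl e
  obtain ⟨x₂, hx₂, S₂, -, hsep₂, hS₂, -, hxD₂⟩ := ha.exists_edge_data hl f
  -- If both last edges cross the same hypersphere, they coincide and induction applies to the
  -- initial parts.
  by_cases hS₁₂ : S₁ = S₂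
  · have h0 : sep a D₁ D₂ = ∅ := by
      rw [ha.sep_eq_symmDiff D₁ D D₂, sep_comm a D D₂, hsep₁, hsep₂, hS₁₂, symmDiff_self,
        Set.bot_eq_empty]
    obtain rfl := ha.chamber_ext (by omega) h0
    obtain rfl := ha.edge_eq hl e f
    rw [Quiver.Path.length_cons] at hp hq
    change posClass (p.comp (Quiver.Hom.toPath e)) = posClass (q.comp (Quiver.Hom.toPath e))
    rw [posClass_comp, posClass_comp, ih _ (by omega) C D₁ rfl p q hp1 hq1]
  have hx₁0 : x₁ ≠ 0 := ne_zero_of_mem_unit_sphere ⟨_, hx₁⟩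
  have hx₂0 : x₂ ≠ 0 := ne_zero_of_mem_unit_sphere ⟨_, hx₂⟩
  have hsepne : (sep a C D).Nonempty := ⟨S₁, hp2 (hsep₁ ▸ rfl)⟩
  have hmem₁ : S₁ ∈ sep a C D := hp2 (hsep₁ ▸ rfl)
  have hmem₂ : S₂ ∈ sep a C D := hq2 (hsep₂ ▸ rfl)
  have hP : finrank ℝ (Submodule.span ℝ {x₁, x₂}) ≤ 2 := by
    classical
    have h1 := finrank_span_finset_le_card (R := ℝ) ({x₁, x₂} : Finset (SphAmbient l))
    rw [Finset.coe_pair] at h1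
    exact h1.trans Finset.card_le_two
  obtain ⟨y, hy, hgen⟩ := ha.exists_generic_direction C (Submodule.span ℝ {x₁, x₂}) (by omega)
  let x : unitInterval → SphAmbient l := fun t => AffineMap.lineMap x₁ x₂ (t : ℝ)
  have hxc : Continuous x := AffineMap.lineMap_continuous.comp continuous_subtype_val
  have hx0 : x 0 = x₁ := by simp [x]
  have hx1 : x 1 = x₂ := by simp [x]
  have hxspan : ∀ t, x t ∈ Submodule.span ℝ {x₁, x₂} := by
    intro t
    simp only [x, AffineMap.lineMap_apply_module]
    exact Submodule.add_mem _
      (Submodule.smul_mem _ _ (Submodule.subset_span (Set.mem_insert _ _)))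
      (Submodule.smul_mem _ _ (Submodule.subset_span (Set.mem_insert_of_mem _ rfl)))
  -- Since `S₁ ≠ S₂`, each of the two functionals vanishing at one end of the segment has the sign
  -- of `D` at the other, so inner points have all the signs of `D`.
  have hxcases : ∀ t, x t = x₁ ∨ x t = x₂ ∨
      ∀ T, SignType.sign (a T (x t)) = SignType.sign (a T D.point) := by
    intro t
    by_cases ht0 : (t : ℝ) = 0
    · left; simp [x, ht0]
    by_cases ht1 : (t : ℝ) = 1
    · right; left; simp [x, ht1]
    right; right
    have ht0' : 0 < (t : ℝ) := lt_of_le_of_ne t.2.1 (Ne.symm ht0)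
    have ht1' : 0 < 1 - (t : ℝ) := sub_pos.2 (lt_of_le_of_ne t.2.2 ht1)
    have hxt : x t = (1 - (t : ℝ)) • x₁ + (t : ℝ) • x₂ := AffineMap.lineMap_apply_module _ _ _
    intro T
    by_cases hT₁ : T = S₁
    · rw [hxt, map_add, map_smul _ _ x₁, (hS₁ T).2 hT₁, smul_zero, zero_add,
        sign_smul_of_pos _ ht0', hxD₂ T (hT₁ ▸ hS₁₂)]
    by_cases hT₂ : T = S₂
    · rw [hxt, map_add, map_smul _ _ x₂, (hS₂ T).2 hT₂, smul_zero, add_zero,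
        sign_smul_of_pos _ ht1', hxD₁ T hT₁]
    rw [sign_apply_segment (a T) ((hxD₂ T hT₂).trans (hxD₁ T hT₁).symm)
      ⟨_, _, ht1'.le, ht0'.le, sub_add_cancel _ _, hxt.symm⟩, hxD₁ T hT₁]
  have step : ∀ t, (exits a (sep a C D) y (x t)).Nonempty ∧
      ∃ E, sep a E D = exits a (sep a C D) y (x t) ∧
        ∀ p q : PosPath E D, p.length = (sep a E D).ncard → q.length = (sep a E D).ncard →
          posClass p = posClass q := by
    intro t
    obtain ⟨hM, r, hr, hz, hzD⟩ := ha.exists_exit_point (q := x t) hsepne hy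
      (fun T hT => by
        have hT₁ : T ≠ S₁ := fun h => hT (h ▸ hmem₁)
        have hT₂ : T ≠ S₂ := fun h => hT (h ▸ hmem₂)
        rcases hxcases t with h | h | h
        · rw [h, hxD₁ T hT₁]
        · rw [h, hxD₂ T hT₂]
        · exact h T)
      (fun T => by
        rcases hxcases t with h | h | h
        · by_cases hT : T = S₁
          · exact Or.inl (by rw [h, hS₁, hT])
          · exact Or.inr (by rw [h, hxD₁ T hT])
        · by_cases hT : T = S₂
          · exact Or.inl (by rw [h, hS₂, hT])
          · exact Or.inr (by rw [h, hxD₂ T hT])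
        · exact Or.inr (h T))
    have hgood : x t + r • y ≠ 0 ∧ l ≤ finrank ℝ (flat a (x t + r • y)) + 1 := by
      -- Genericity says nothing at `r = 0`, but there the exit point is `x t` itself, which lies on
      -- at most one hypersphere.
      by_cases hr0 : r = 0
      · rw [hr0, zero_smul, add_zero]
        rcases hxcases t with h | h | h
        · rw [h, ha.finrank_flat_of_forall_iff hS₁]
          exact ⟨hx₁0, by omega⟩
        · rw [h, ha.finrank_flat_of_forall_iff hS₂]
          exact ⟨hx₂0, by omega⟩
        · have hne : ∀ T, a T (x t) ≠ 0 := fun T => by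
            rw [← sign_ne_zero, h, sign_ne_zero]; exact ha.point_ne_zero D T
          rw [finrank_flat_of_ne_zero hne]
          exact ⟨fun h0 => hne S₁ (by rw [h0, map_zero]), by omega⟩
      · have := hgen (x t) (hxspan t) r hr0
        exact ⟨this.1, by omega⟩
    obtain ⟨E, hE⟩ := ha.exists_chamber_flip (by omega) hM (fun _ h => h.1) hy hz hzD
    refine ⟨hM, E, hE, fun p q hp hq => ?_⟩
    rw [← hE] at hM hz hzD
    exact ha.posClass_eq_of_flat hl hgood.1 hM hz hzD hgood.2 p q hp hq
  choose hM E hE hEq using step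
  have hsub : ∀ t, sep a (E t) D ⊆ sep a C D := fun t => (hE t).symm ▸ fun _ h => h.1
  have hlt : ∀ t, (sep a C (E t)).ncard < n := by
    intro t
    have h1 := ha.ncard_sep_of_subset (hsub t)
    have h2 : 0 < (sep a (E t) D).ncard := (Set.ncard_pos).2 (by rw [hE]; exact hM t)
    omega
  choose g hg using fun t => ha.exists_geodesic hl C (E t)
  choose k hk using fun t => ha.exists_geodesic hl (E t) D
  -- The exit set determines the intermediate chamber, and the chosen geodesics on either side of it
  -- do not matter.
  have hany : ∀ t X, sep a X D = exits a (sep a C D) y (x t) →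
      ∀ (p : PosPath C X) (q : PosPath X D), p.length = (sep a C X).ncard →
        q.length = (sep a X D).ncard →
        posClass p ≫ posClass q = posClass (g t) ≫ posClass (k t) := by
    intro t X hX p q hp hq
    have h0 : sep a X (E t) = ∅ := by
      rw [ha.sep_eq_symmDiff X D (E t), sep_comm a D, hX, hE, symmDiff_self, Set.bot_eq_empty]
    obtain rfl := ha.chamber_ext (by omega) h0
    rw [hEq t q (k t) hq (hk t), ih _ (hlt t) C (E t) rfl p (g t) hp (hg t)]
  -- For `s` near `t` the exit set at `s` is contained in that at `t`, so `E s` lies between `E t`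
  -- and `D`. Both classes then equal that of a geodesic from `C` through `E t` and `E s` to `D`.
  have hloc : IsLocallyConstant fun t => posClass (g t) ≫ posClass (k t) := by
    rw [IsLocallyConstant.iff_eventually_eq]
    intro t
    filter_upwards [hxc.continuousAt.eventually
      (eventually_exits_subset (a := a) (sep a C D) y (x t))] with s hs
    rw [← hE, ← hE] at hs
    obtain ⟨j, hj⟩ := ha.exists_geodesic hl (E t) (E s)
    have h1 := ha.ncard_sep_of_subset (hsub t)
    have h2 := ha.ncard_sep_of_subset (hsub s)
    have h3 := ha.ncard_sep_of_subset hs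
    have h4 : posClass (g s) = posClass (g t) ≫ posClass j := by
      rw [← posClass_comp]
      exact ih _ (hlt s) C (E s) rfl _ _ (hg s) (by
        rw [Quiver.Path.length_comp, hg, hj]; omega)
    have h5 : posClass (k t) = posClass j ≫ posClass (k s) := by
      rw [← posClass_comp]
      exact hEq t _ _ (hk t) (by rw [Quiver.Path.length_comp, hj, hk]; omega)
    rw [h4, h5, Category.assoc]
  have hends := hloc.apply_eq_of_preconnectedSpace 0 1
  -- At an end of the segment the ray starts on the wall, so the exit set is that wall alone and the
  -- intermediate chamber is the one the given path visits before `D`.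
  have hstart := hany 0 D₁ (by rw [hx0, hsep₁, ha.exits_eq_singleton hmem₁ hy hS₁ hxD₁])
    p (Quiver.Hom.toPath e) hp1 (by rw [hsep₁, Set.ncard_singleton]; rfl)
  have hend := hany 1 D₂ (by rw [hx1, hsep₂, ha.exits_eq_singleton hmem₂ hy hS₂ hxD₂])
    q (Quiver.Hom.toPath f) hq1 (by rw [hsep₂, Set.ncard_singleton]; rfl)
  change posClass (p.comp (Quiver.Hom.toPath e)) = posClass (q.comp (Quiver.Hom.toPath f))
  rw [posClass_comp, posClass_comp, hstart, hend]
  exact hends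

end SphereArrangement

theorem mainTheorem4 (l : ℕ) (hl : 2 ≤ l) (A : SphereArrangement l)
    (hA : A.CentrallySymmetric) :
    (∀ (C D : A.Chamber) (α β : SphereArrangement.PosPath C D),
      SphereArrangement.IsMinimal α → SphereArrangement.IsMinimal β →
        A.J.map (SphereArrangement.posClass α) = A.J.map (SphereArrangement.posClass β) →
          SphereArrangement.posClass α = SphereArrangement.posClass β) ∧
    (∀ (C D : A.Chamber) (α β : SphereArrangement.PosPath C D),
      SphereArrangement.IsMinimal α → SphereArrangement.IsMinimal β →
        SphereArrangement.posClass α = SphereArrangement.posClass β) := by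
  obtain ⟨a, ha⟩ := hA.exists_isDefining
  have key : ∀ (C D : A.Chamber) (α β : SphereArrangement.PosPath C D),
      SphereArrangement.IsMinimal α → SphereArrangement.IsMinimal β →
        SphereArrangement.posClass α = SphereArrangement.posClass β :=
    fun C D α β hα hβ => ha.posClass_eq_of_geodesic hl _ C D rfl α β
      (ha.length_eq_of_isMinimal hl hα) (ha.length_eq_of_isMinimal hl hβ)
  exact ⟨fun C D α β hα hβ _ => key C D α β hα hβ, key⟩
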